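/- **Setting.** Let $N\ge 1$, $L,n\ge 0$ be integers, $\omega$ a primitive $N$th root of unity, and $k,k'\in\mathbb C$ with $k\ne 0$, $k^2+k'^2=1$. A rapidity is a triple $p=(x_p,y_p,\mu_p)\in\mathbb C^3$ with $\mu_p\neq0$, $kx_p^N=1-k'\mu_p^{-N}$, $ky_p^N=1-k'\mu_p^N$; put $t_p=x_py_p$ and $\bar p=(y_p,x_p,\mu_p^{-1})$. For $n\in\mathbb Z_N$ (represented in $\{0,\dots,N-1\}$) let $$\frac{W_{pq}(n)}{W_{pq}(0)}=\prod_{j=1}^n\frac{\mu_p}{\mu_q}\frac{y_q-x_p\omega^j}{y_p-x_q\omega^j},\qquad \frac{\bar W_{pq}(n)}{\bar W_{pq}(0)}=\prod_{j=1}^n\mu_p\mu_q\frac{x_p\omega-x_q\omega^j}{y_q-y_p\omega^j},\qquad \widehat W_{pq}(n)=\sum_{m=0}^{N-1}\omega^{-nm}W_{pq}(m).$$ On $\mathbb C^N$ with basis $v_\sigma$ ($\sigma\in\mathbb Z_N$) let $Zv_\sigma=\omega^\sigma v_\sigma$, $Xv_\sigma=v_{\sigma+1}$; let $P(v_\sigma\otimes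 v_\tau)=v_\tau\otimes v_\sigma$ and $$S(p,p';q,q')=\frac1{N^2}P\sum_{n_1,n_2,n_3,n_4\in\mathbb Z_N}\frac{\widehat W_{pq'}(n_1)}{W_{pq'}(0)}\frac{\bar W_{pq}(n_2)}{\bar W_{pq}(0)}\frac{\bar W_{p'q'}(n_3)}{\bar W_{p'q'}(0)}\frac{\widehat W_{p'q}(n_4)}{W_{p'q}(0)}\;X^{n_1}Z^{n_2}X^{n_4}\otimes X^{-n_1}Z^{n_3}X^{-n_4}.$$ Given rapidities $p_1,\dots,p_L$, let $S_i(p,p';q,q')$ act as $S(p,p';q,q')$ on the $i$th factor of $(\mathbb C^N)^{\otimes L}$ and an auxiliary space $\mathbb C^N$, and as the identity on the other factors. Let $T^{\tau'}_\tau\in\mathrm{End}((\mathbb C^N)^{\otimes L})$ ($\tau',\tau\in\mathbb Z_N$) be the entry in row $\tau'$ and column $\tau$, with respect to the auxiliary space, of the monodromy matrix $T(q_1,q_2;\{p\})=S_1(p_1,\bar p_1;q_1,q_2)\cdots S_L(p_L,\bar p_L;q_1,q_2)$. Let $$\begin{pmatrix}A(z)&B(z)\\C(z)&D(z)\end{pmatrix}=\mathcal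 L_1(z)\cdots\mathcal L_L(z),\qquad \mathcal L_i(z)=\begin{pmatrix}-t_{p_i}z+Z_i&-y_{p_i}z(1-Z_i)X_i\\x_{p_i}X_i^{-1}(1-Z_i)&1-t_{p_i}z\omega Z_i\end{pmatrix},$$ where $X_i$, $Z_i$ are $X$, $Z$ acting on the $i$th factor. Put $|0\rangle=v_0\otimes\cdots\otimes v_0$, $a(z)=\prod_{m=1}^L(1-t_{p_m}z)$ and $d(z)=\prod_{m=1}^L(1-t_{p_m}z\omega)$. **Proposition.** Let $q=(x_q,y_q,\mu_q)$ be a rapidity with $x_{p_i}\ne x_q\omega^m$ and $y_{p_i}\neq y_q\omega^m$ for all $i$ and $m$, let $s\in\{0,\dots,N-1\}$, and set $q_1=q$, $q_2=\bar q(s)=(y_q,x_q\omega^s,\mu_q^{-1})$. Let $z_1,\dots,z_n\in\mathbb C$ be distinct with $t_qz_i\omega^m\neq1$ for all $i$ and $m$, and write $B_i=B(z_i)$. Then for all $\tau,\tau'\in\mathbb Z_N$ $$B_1\cdots B_n\,T^{\tau'}_\tau|0\rangle=\sum_{I,J,K}c_n^{\tau'\tau}(I;J;K)\;\prod_{j\in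 J}a(z_j)\prod_{k\in K}d(z_k)\;T^{\tau'-n_D}_{\tau+n_A}\,B_{i_1}\cdots B_{i_{n_B}}|0\rangle,$$ where the sum is over all triples of pairwise disjoint subsets $I=\{i_1,\dots,i_{n_B}\}$, $J=\{j_1,\dots,j_{n_A}\}$, $K=\{k_1,\dots,k_{n_D}\}$ of $\{1,\dots,n\}$ with $n_B+n_A+n_D=n$ (each set enumerated without repetition in an arbitrary fixed order), and $$c_n^{\tau'\tau}(I;J;K)=\prod_{\ell=1}^{n_B}\frac1{\mu_{\tau'\tau}(z_{i_\ell})}\prod_{\ell=1}^{n_A}\frac{\nu_{\tau+\ell}(z_{j_\ell})}{\mu_{\tau',\tau+\ell-1}(z_{j_\ell})}\prod_{\ell=1}^{n_D}\frac{-\nu_{\tau'-\ell+1}(z_{k_\ell})}{\mu_{\tau'-\ell+1,\tau}(z_{k_\ell})}\prod_{i\in I,\,j\in J}\omega f_{ji}\prod_{i\in I,\,k\in K}\omega f_{ik}\prod_{j\in J,\,k\in K}\omega f_{jk},$$ $$\mu_{\tau'\tau}(z)=\frac{(t_qz-1)(t_qz\omega^s-1)\omega^{\tau'}}{(t_qz\omega^{\tau'}-1)(t_qz\omega^{\tau+1}-1)},\qquad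 \nu_\tau(z)=\frac{y_qz(1-\omega^\tau)}{t_qz\omega^\tau-1},\qquad f_{ij}=\frac{z_i-z_j\omega}{(z_i-z_j)\omega}.$$ -/

import Mathlib

open scoped Matrix Kronecker

namespace SCP

noncomputable section

/-- A rapidity: a triple `(x, y, μ)` of complex numbers. -/
structure Rapidity where
  x : ℂ
  y : ℂ
  μ : ℂ

namespace Rapidity

/-- The rapidity lies on the Fermat curve `k x ^ N = 1 - k' μ ^ (-N)`, `k y ^ N = 1 - k' μ ^ N`
(the relation `k ^ 2 + k' ^ 2 = 1` between the moduli is a separate hypothesis). -/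
def OnCurve (N : ℕ) (k k' : ℂ) (p : Rapidity) : Prop :=
  p.μ ≠ 0 ∧ k * p.x ^ N = 1 - k' * p.μ⁻¹ ^ N ∧ k * p.y ^ N = 1 - k' * p.μ ^ N

/-- `p ↦ (y, x, μ⁻¹)`. -/
def bar (p : Rapidity) : Rapidity := ⟨p.y, p.x, p.μ⁻¹⟩

/-- `q ↦ (y, x ω ^ s, μ⁻¹)`. -/
def barShift {N : ℕ} (ω : ℂ) (s : ZMod N) (q : Rapidity) : Rapidity :=
  ⟨q.y, q.x * ω ^ s.val, q.μ⁻¹⟩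

/-- `t = x y`. -/
def t (p : Rapidity) : ℂ := p.x * p.y

end Rapidity

/-! ### Boltzmann weights, normalised by their value at `0` -/

/-- `W_{pq}(n) / W_{pq}(0)`. -/
def W {N : ℕ} (ω : ℂ) (p q : Rapidity) (n : ZMod N) : ℂ :=
  ∏ j ∈ Finset.Icc 1 n.val, p.μ / q.μ * ((q.y - p.x * ω ^ j) / (p.y - q.x * ω ^ j))

/-- `W̄_{pq}(n) / W̄_{pq}(0)`. -/
def Wbar {N : ℕ} (ω : ℂ) (p q : Rapidity) (n : ZMod N) : ℂ :=
  ∏ j ∈ Finset.Icc 1 n.val, p.μ * q.μ * ((p.x * ω - q.x * ω ^ j) / (q.y - p.y * ω ^ j))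

/-- The Fourier transform of `W`, divided by `W_{pq}(0)`. -/
def What {N : ℕ} [NeZero N] (ω : ℂ) (p q : Rapidity) (n : ZMod N) : ℂ :=
  ∑ m : ZMod N, ω ^ ((-(n * m)).val) * W ω p q m

/-! ### Operators on the local space with basis `v_σ`, `σ ∈ ℤ / N` -/

/-- `Xop m` is the power `X ^ m` of the cyclic shift `X v_σ = v_{σ+1}`; `X⁻¹` is `Xop (-1)`. -/
def Xop {N : ℕ} (m : ZMod N) : Matrix (ZMod N) (ZMod N) ℂ :=
  Matrix.of fun a b => if a = b + m then 1 else 0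

/-- `Zop ω m` is the power `Z ^ m` of `Z v_σ = ω ^ σ v_σ`. -/
def Zop {N : ℕ} (ω : ℂ) (m : ZMod N) : Matrix (ZMod N) (ZMod N) ℂ :=
  Matrix.diagonal fun σ => (ω ^ σ.val) ^ m.val

/-- The permutation operator `v_σ ⊗ v_τ ↦ v_τ ⊗ v_σ`. -/
def permOp (N : ℕ) : Matrix (ZMod N × ZMod N) (ZMod N × ZMod N) ℂ :=
  Matrix.of fun a b => if a = b.swap then 1 else 0

/-- The Boltzmann weight `w_{pp'qq'}(n₁, n₂, n₃, n₄)`. -/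
def w {N : ℕ} [NeZero N] (ω : ℂ) (p p' q q' : Rapidity) (n₁ n₂ n₃ n₄ : ZMod N) : ℂ :=
  What ω p q' n₁ * Wbar ω p q n₂ * Wbar ω p' q' n₃ * What ω p' q n₄

/-- The operator `S(p, p'; q, q')` on the tensor product of two local spaces. -/
def S {N : ℕ} [NeZero N] (ω : ℂ) (p p' q q' : Rapidity) :
    Matrix (ZMod N × ZMod N) (ZMod N × ZMod N) ℂ :=
  (1 / (N : ℂ) ^ 2) • (permOp N *
    ∑ n₁ : ZMod N, ∑ n₂ : ZMod N, ∑ n₃ : ZMod N, ∑ n₄ : ZMod N,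
      w ω p p' q q' n₁ n₂ n₃ n₄ •
        ((Xop n₁ * Zop ω n₂ * Xop n₄) ⊗ₖ (Xop (-n₁) * Zop ω n₃ * Xop (-n₄))))

/-- The cyclic `L`-operator, a `2 × 2` matrix of operators on the local space. -/
def cyclicL {N : ℕ} [NeZero N] (ω : ℂ) (p p' : Rapidity) (z : ℂ) :
    Matrix (Fin 2) (Fin 2) (Matrix (ZMod N) (ZMod N) ℂ) :=
  !![(-(p.y * p'.y * z)) • 1 + (p.μ * p'.μ) • Zop ω 1,
      (-z) • ((p.y • 1 - (p'.x * p.μ * p'.μ) • Zop ω 1) * Xop 1);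
    Xop (-1) * (p'.y • 1 - (p.x * p.μ * p'.μ) • Zop ω 1),
      1 - (p.x * p'.x * p.μ * p'.μ * z * ω) • Zop ω 1]

/-! ### The chain with `L` sites -/

/-- Spin configurations; they index the basis `v_{σ₁} ⊗ ⋯ ⊗ v_{σ_L}` of the quantum space. -/
abbrev Config (N L : ℕ) := Fin L → ZMod N

/-- Operators on the quantum space `(ℂ^N)^{⊗ L}`. -/
abbrev ChainOp (N L : ℕ) := Matrix (Config N L) (Config N L) ℂ

/-- The operator that acts as `M` on the `i`th factor and as the identity on the others. -/
def siteOp {N L : ℕ} (i : Fin L) (M : Matrix (ZMod N) (ZMod N) ℂ) : ChainOp N L :=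
  Matrix.of fun σ σ' => if ∀ j, j ≠ i → σ j = σ' j then M (σ i) (σ' i) else 0

/-- The reference state `v₀ ⊗ ⋯ ⊗ v₀`. -/
def vac (N L : ℕ) : Config N L → ℂ := Pi.single 0 1

/-- `S_i`, an operator on quantum space `⊗` auxiliary space, as a matrix over the auxiliary
space whose entries are operators on the quantum space. -/
def Ssite {N L : ℕ} [NeZero N] (ω : ℂ) (p p' q q' : Rapidity) (i : Fin L) :
    Matrix (ZMod N) (ZMod N) (ChainOp N L) :=
  Matrix.of fun τ' τ => siteOp i (Matrix.of fun a b => S ω p p' q q' (a, τ') (b, τ))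

/-- The superintegrable monodromy matrix `T(q₁, q₂; {p}) = S_1 ⋯ S_L` with `p'_i = p̄_i`.
Its entry `T^{τ'}_τ` is `scpT ω p q₁ q₂ τ' τ` (row `τ'`, column `τ`). -/
def scpT {N L : ℕ} [NeZero N] (ω : ℂ) (p : Fin L → Rapidity) (q₁ q₂ : Rapidity) :
    Matrix (ZMod N) (ZMod N) (ChainOp N L) :=
  (List.ofFn fun i : Fin L => Ssite ω (p i) (p i).bar q₁ q₂ i).prod

/-- The monodromy matrix `𝒯(z; {p}) = ℒ_1 ⋯ ℒ_L` of the `τ₂`-model. -/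
def tau2T {N L : ℕ} [NeZero N] (ω : ℂ) (p : Fin L → Rapidity) (z : ℂ) :
    Matrix (Fin 2) (Fin 2) (ChainOp N L) :=
  (List.ofFn fun i : Fin L => (cyclicL ω (p i) (p i).bar z).map (siteOp i)).prod

/-- The operator `B(z)`, the upper right entry of `𝒯(z; {p})`. -/
def B {N L : ℕ} [NeZero N] (ω : ℂ) (p : Fin L → Rapidity) (z : ℂ) : ChainOp N L :=
  tau2T ω p z 0 1

/-- The eigenvalue `a(z)` of the upper left entry `A(z)` on the reference state. -/
def a {L : ℕ} (p : Fin L → Rapidity) (z : ℂ) : ℂ := ∏ m, (1 - (p m).t * z)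

/-- The eigenvalue `d(z)` of the lower right entry `D(z)` on the reference state. -/
def d {L : ℕ} (ω : ℂ) (p : Fin L → Rapidity) (z : ℂ) : ℂ := ∏ m, (1 - (p m).t * z * ω)

/-! ### The coefficients -/

/-- `μ_{τ'τ}(z)`. -/
def mu {N : ℕ} (ω : ℂ) (s : ZMod N) (q : Rapidity) (τ' τ : ZMod N) (z : ℂ) : ℂ :=
  (q.t * z - 1) * (q.t * z * ω ^ s.val - 1) * ω ^ τ'.val /
    ((q.t * z * ω ^ τ'.val - 1) * (q.t * z * ω ^ (τ + 1).val - 1))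

/-- `ν_τ(z)`. -/
def nu {N : ℕ} (ω : ℂ) (q : Rapidity) (τ : ZMod N) (z : ℂ) : ℂ :=
  q.y * z * (1 - ω ^ τ.val) / (q.t * z * ω ^ τ.val - 1)

/-- `f_{ij}` is `f ω (z i) (z j)`. -/
def f (ω u v : ℂ) : ℂ := (u - v * ω) / ((u - v) * ω)

/-- The coefficient `c_n^{τ'τ}(I; J; K)`. The sets `J` and `K` are enumerated by `eJ` and `eK`;
the index `ℓ` of the enumerations starts at `0` here, so it stands for `ℓ + 1 = 1, 2, …`. -/
def coeff {N n : ℕ} (ω : ℂ) (s : ZMod N) (q : Rapidity) (z : Fin n → ℂ) (τ' τ : ZMod N)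
    (I J K : Finset (Fin n)) (eJ : Fin J.card ≃ J) (eK : Fin K.card ≃ K) : ℂ :=
  (∏ i ∈ I, 1 / mu ω s q τ' τ (z i)) *
  (∏ ℓ : Fin J.card,
    nu ω q (τ + (ℓ.val : ZMod N) + 1) (z (eJ ℓ)) / mu ω s q τ' (τ + (ℓ.val : ZMod N)) (z (eJ ℓ))) *
  (∏ ℓ : Fin K.card,
    -nu ω q (τ' - (ℓ.val : ZMod N)) (z (eK ℓ)) / mu ω s q (τ' - (ℓ.val : ZMod N)) τ (z (eK ℓ))) *
  (∏ i ∈ I, ∏ j ∈ J, ω * f ω (z j) (z i)) *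
  (∏ i ∈ I, ∏ k ∈ K, ω * f ω (z i) (z k)) *
  (∏ j ∈ J, ∏ k ∈ K, ω * f ω (z j) (z k))

/-- The triples `(I, J, K)` of pairwise disjoint subsets of the index set whose numbers of
elements add up to `n`. -/
def triples (n : ℕ) : Finset (Finset (Fin n) × Finset (Fin n) × Finset (Fin n)) :=
  Finset.univ.filter fun P =>
    Disjoint P.1 P.2.1 ∧ Disjoint P.1 P.2.2 ∧ Disjoint P.2.1 P.2.2 ∧
      P.1.card + P.2.1.card + P.2.2.card = n

end

end SCP

/-! # Bethe vectors of the `τ₂`-model under the superintegrable monodromy matrix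

Write `F(u, v) = (u - ω v) / (u - v) = ω f(u, v)` and `g(u, v) = (ω - 1) v / (u - v)`
(`exchF`, `exchG`). The formula for `B(z₁) ⋯ B(zₙ) T |0⟩` is obtained by reading `B(z)`, acting on
vectors of the form `T^{τ'}_τ · |0⟩`, as the `B`-operator of a composite of three pieces: a row
space, which carries the index `τ'`, the chain itself, and a column space, which carries `τ`.

*Intertwining.* `S(p, p'; q, q')` is the permutation composed with four elementary intertwiners,
Fourier series in `X ⊗ X⁻¹` or in `Z`, each of which exchanges two neighbouring rapidities in a
product of two cyclic `L`-operators (`powSum_X_mul_Lop`, `powSum_Z_mul_Lop`). What makes them work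
is that the recursions of the weights hold on all of `ℤ / N`, with no defect between `N - 1` and
`0`; this is where the curve equations enter (`W_add_one`, `Wbar_add_one`). Hence `S` satisfies a
Yang–Baxter relation with two `L`-operators (`S_mul_cyclicL`), and the product `T` of the `S_i`
satisfies `T (𝒯 ℓ) = (ℓ 𝒯) T`, where `𝒯` is the monodromy matrix of the `τ₂`-model and `ℓ` the
`L`-operator on the auxiliary space with rapidities `q` and `q̄(s)` (`scpT_mul_bigT_mul_auxL`). For
these rapidities there are explicit `α`, `β` (`rowA`, `rowB`) with `(α, β) ℓ = (1, 0)`, thanks to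
`t_q z ω ^ m ≠ 1`. Multiplying the second column of the relation by `(α, β)` gives
`B T = α T (𝒯 ℓ)_{01} + β T (𝒯 ℓ)_{11}` (`B_mul_rowPair`).

*Exchange relations.* The cyclic `L`-operator satisfies an exchange relation with a twisted
six-vertex `R`-matrix (`isRTT_cyclicL`), which products inherit. It gives
`A(u) B(v) = F(u, v) B(v) A(u) + g(u, v) B(u) A(v)`,
`D(u) B(v) = F(v, u) B(v) D(u) - g(u, v) B(u) D(v)`, and that the `B(z)` commute. These
determine the action of `A` and `D` on a Bethe vector (`apply_betheVector`).

*Splitting.* For a composite of two pieces, `B` acts as `A ⊗ B + B ⊗ D`. Expanding the Bethe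
vector of the composite by induction, the unwanted terms of `A` on the first piece and of `D` on
the second cancel in pairs, because their coefficients `g` and `-g` are opposite; what is left is a
sum over the ways to distribute the parameters between the two pieces (`composite_betheVector`).
Splitting off the row space selects the set `K` (`B_prod_mul_scpT`), splitting the rest into chain
and column space selects `I` and `J` (`extT_betheVector`). On the row and the column space the
`B`-operators are weighted shifts, so their Bethe vectors are explicit (`rowVector`, `colVector`)
and produce the shifts `τ' - n_D` and `τ + n_A`; `coeff_eq` recognizes the coefficient.

The operator identities are proved after multiplication by the projector onto `|0⟩` (`vacProj`), so
that the Bethe vectors of the chain are elements of the operator algebra. -/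

namespace SCP

noncomputable section

/-! ### Bethe vectors and their splitting over a composite -/

section BetheVectors

variable {ι : Type*} [DecidableEq ι]

/-- Action of a diagonal entry `α` of a monodromy matrix on a Bethe vector
`b(S) = ∏_{i ∈ S} β_i b(∅)`: a wanted term proportional to `b(S)`, and unwanted terms in which one
parameter of `S` is replaced by that of `α`. The identity `hPQ` between the exchange coefficients is
what makes the coefficient of an unwanted term a product. -/
theorem apply_betheVector {M : Type*} [AddCommGroup M] [Module ℂ M]
    (α β : ι → M →ₗ[ℂ] M) (P Q : ι → ι → ℂ) (b : Finset ι → M) (a : ι → ℂ)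
    (hb : ∀ i S, i ∉ S → b (insert i S) = β i (b S))
    (hvac : ∀ i, α i (b ∅) = a i • b ∅)
    (hαβ : ∀ i j, i ≠ j → ∀ x,
      α i (β j x) = P i j • β j (α i x) + Q i j • β i (α j x))
    (hPQ : ∀ i j k, i ≠ j → i ≠ k → j ≠ k →
      P i j * Q i k + Q i j * Q j k = Q i k * P k j)
    (S : Finset ι) (i : ι) (hi : i ∉ S) :
    α i (b S) = (a i * ∏ j ∈ S, P i j) • b S +
      ∑ j ∈ S, (a j * Q i j * ∏ l ∈ S.erase j, P j l) • b (insert i (S.erase j)) := by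
  induction S using Finset.induction_on generalizing i with
  | empty => simp [hvac]
  | insert m S hm ih =>
    have him : i ≠ m := fun h => hi (h ▸ Finset.mem_insert_self _ _)
    have hiS : i ∉ S := fun h => hi (Finset.mem_insert_of_mem h)
    rw [hb m S hm, hαβ i m him, ih i hiS, ih m hm, Finset.sum_insert hm, Finset.prod_insert hm,
      Finset.erase_insert hm, hb i S hiS]
    simp only [map_add, map_smul, map_sum, smul_add, smul_smul, Finset.smul_sum]
    have key : ∀ j ∈ S,
        (a j * Q i j * ∏ l ∈ (insert m S).erase j, P j l) • b (insert i ((insert m S).erase j)) =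
        (P i m * (a j * Q i j * ∏ l ∈ S.erase j, P j l)) • β m (b (insert i (S.erase j))) +
        (Q i m * (a j * Q m j * ∏ l ∈ S.erase j, P j l)) • β i (b (insert m (S.erase j))) := by
      intro j hj
      have hjm : m ≠ j := fun h => hm (h ▸ hj)
      have hij : i ≠ j := fun h => hiS (h ▸ hj)
      have hmS : m ∉ S.erase j := fun h => hm (Finset.mem_of_mem_erase h)
      have hiSj : i ∉ insert m (S.erase j) := by
        simp only [Finset.mem_insert, Finset.mem_erase, not_or, not_and]
        exact ⟨him, fun _ => hiS⟩
      have hmSi : m ∉ insert i (S.erase j) := by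
        simp only [Finset.mem_insert, Finset.mem_erase, not_or, not_and]
        exact ⟨him.symm, fun _ => hm⟩
      -- The same vector arises from the replacement of `j` by `i` in `S`, with `β_m` moved to the
      -- left, and from the replacement of `i` by `m` followed by that of `m` by `j`.
      rw [Finset.erase_insert_of_ne hjm, Finset.prod_insert hmS, ← hb _ _ hmSi, ← hb _ _ hiSj,
        Finset.insert_comm m i, ← add_smul]
      congr 1
      linear_combination (-(a j * ∏ l ∈ S.erase j, P j l)) * hPQ i m j him hij hjm
    rw [Finset.sum_congr rfl key, Finset.sum_add_distrib]
    have e1 : P i m * (a i * ∏ j ∈ S, P i j) = a i * (P i m * ∏ j ∈ S, P i j) := by ring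
    have e2 : Q i m * (a m * ∏ j ∈ S, P m j) = a m * Q i m * ∏ j ∈ S, P m j := by ring
    rw [e1, e2]
    abel

/-- Bethe vectors of a composite system, in which `β` acts as `α ⊗ β₂ + β₁ ⊗ δ`: a sum over all ways
to distribute the parameters between the two parts. The hypotheses `hα` and `hδ` are the actions of
the diagonal entries on the Bethe vectors of the two parts, in the form given by
`apply_betheVector`; the coefficients `g` and `-g` of their unwanted terms are opposite. -/
theorem composite_betheVector {M₁ M₂ M : Type*} [AddCommGroup M₁] [Module ℂ M₁]
    [AddCommGroup M₂] [Module ℂ M₂] [AddCommGroup M] [Module ℂ M]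
    (pair : M₁ →ₗ[ℂ] M₂ →ₗ[ℂ] M) (α β₁ : ι → M₁ →ₗ[ℂ] M₁) (δ β₂ : ι → M₂ →ₗ[ℂ] M₂)
    (β : ι → M →ₗ[ℂ] M) (F g : ι → ι → ℂ) (a d : ι → ℂ)
    (b₁ : Finset ι → M₁) (b₂ : Finset ι → M₂) (b : Finset ι → M)
    (hb₁ : ∀ i S, i ∉ S → b₁ (insert i S) = β₁ i (b₁ S))
    (hb₂ : ∀ i S, i ∉ S → b₂ (insert i S) = β₂ i (b₂ S))
    (hb : ∀ i S, i ∉ S → b (insert i S) = β i (b S))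
    (hvac : b ∅ = pair (b₁ ∅) (b₂ ∅))
    (hβ : ∀ i x y, β i (pair x y) = pair (α i x) (β₂ i y) + pair (β₁ i x) (δ i y))
    (hα : ∀ S i, i ∉ S → α i (b₁ S) = (a i * ∏ j ∈ S, F i j) • b₁ S +
      ∑ j ∈ S, (a j * g i j * ∏ l ∈ S.erase j, F j l) • b₁ (insert i (S.erase j)))
    (hδ : ∀ S i, i ∉ S → δ i (b₂ S) = (d i * ∏ j ∈ S, F j i) • b₂ S +
      ∑ j ∈ S, (d j * -g i j * ∏ l ∈ S.erase j, F l j) • b₂ (insert i (S.erase j)))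
    (S : Finset ι) :
    b S = ∑ I ∈ S.powerset,
      ((∏ i ∈ I, ∏ j ∈ S \ I, F j i) * (∏ j ∈ S \ I, a j) * ∏ i ∈ I, d i) •
        pair (b₁ I) (b₂ (S \ I)) := by
  induction S using Finset.induction_on with
  | empty => simp [hvac]
  | insert m S hm ih =>
    set c : Finset ι → Finset ι → ℂ := fun I J =>
      (∏ i ∈ I, ∏ j ∈ J, F j i) * (∏ j ∈ J, a j) * ∏ i ∈ I, d i with hc
    have ih' : b S = ∑ I ∈ S.powerset, c I (S \ I) • pair (b₁ I) (b₂ (S \ I)) := ih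
    -- The new parameter `m` joins the second part or the first part, up to unwanted terms.
    have step : ∀ I ∈ S.powerset, c I (S \ I) • β m (pair (b₁ I) (b₂ (S \ I))) =
        (c I (insert m S \ I) • pair (b₁ I) (b₂ (insert m S \ I)) +
         c (insert m I) (insert m S \ insert m I) •
          pair (b₁ (insert m I)) (b₂ (insert m S \ insert m I))) +
        (∑ j ∈ I, (c I (S \ I) * (a j * g m j * ∏ l ∈ I.erase j, F j l)) •
            pair (b₁ (insert m (I.erase j))) (b₂ (insert m (S \ I))) +
         ∑ j ∈ S \ I, (c I (S \ I) * (d j * -g m j * ∏ l ∈ (S \ I).erase j, F l j)) •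
            pair (b₁ (insert m I)) (b₂ (insert m ((S \ I).erase j)))) := by
      intro I hI
      rw [Finset.mem_powerset] at hI
      have hmI : m ∉ I := fun h => hm (hI h)
      have hmJ : m ∉ S \ I := fun h => hm (Finset.mem_sdiff.1 h).1
      have s1 : insert m S \ I = insert m (S \ I) := Finset.insert_sdiff_of_notMem _ hmI
      have s2 : insert m S \ insert m I = S \ I := by
        rw [Finset.insert_sdiff_insert, Finset.sdiff_insert, Finset.erase_eq_of_notMem hmJ]
      rw [hβ, hα I m hmI, hδ _ m hmJ, s1, s2, ← hb₁ m I hmI, ← hb₂ m _ hmJ]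
      simp only [map_add, map_smul, map_sum, smul_add, smul_smul, Finset.smul_sum,
        LinearMap.add_apply, LinearMap.smul_apply, LinearMap.sum_apply]
      have e1 : c I (insert m (S \ I)) = c I (S \ I) * (a m * ∏ j ∈ I, F m j) := by
        simp only [hc, Finset.prod_insert hmJ, Finset.prod_mul_distrib]; ring
      have e2 : c (insert m I) (S \ I) = c I (S \ I) * (d m * ∏ j ∈ S \ I, F j m) := by
        simp only [hc, Finset.prod_insert hmI]; ring
      rw [e1, e2]
      abel
    -- The unwanted terms cancel in pairs: the term of `(I, j)` with `j ∉ I` from `δ` is opposite to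
    -- the term of `(I ∪ {j}, j)` from `α`, as both pair `b₁ (I ∪ {m})` with `b₂ (S \ I ∪ {m} \ {j})`.
    have cancel : ∑ I ∈ S.powerset, ∑ j ∈ S \ I,
          (c I (S \ I) * (d j * -g m j * ∏ l ∈ (S \ I).erase j, F l j)) •
            pair (b₁ (insert m I)) (b₂ (insert m ((S \ I).erase j))) =
        - ∑ I ∈ S.powerset, ∑ j ∈ I, (c I (S \ I) * (a j * g m j * ∏ l ∈ I.erase j, F j l)) •
            pair (b₁ (insert m (I.erase j))) (b₂ (insert m (S \ I))) := by
      rw [← Finset.sum_neg_distrib]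
      simp only [← Finset.sum_neg_distrib]
      rw [Finset.sum_sigma', Finset.sum_sigma']
      refine Finset.sum_bij' (fun x _ => ⟨insert x.2 x.1, x.2⟩) (fun x _ => ⟨x.1.erase x.2, x.2⟩)
        ?_ ?_ ?_ ?_ ?_
      · rintro ⟨I, j⟩ h
        simp only [Finset.mem_sigma, Finset.mem_powerset, Finset.mem_sdiff] at h ⊢
        exact ⟨Finset.insert_subset h.2.1 h.1, Finset.mem_insert_self _ _⟩
      · rintro ⟨I, j⟩ h
        simp only [Finset.mem_sigma, Finset.mem_powerset, Finset.mem_sdiff] at h ⊢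
        exact ⟨(Finset.erase_subset _ _).trans h.1, h.1 h.2, Finset.notMem_erase _ _⟩
      · rintro ⟨I, j⟩ h
        simp only [Finset.mem_sigma, Finset.mem_powerset, Finset.mem_sdiff] at h ⊢
        simp [Finset.erase_insert h.2.2]
      · rintro ⟨I, j⟩ h
        simp only [Finset.mem_sigma, Finset.mem_powerset] at h ⊢
        simp [Finset.insert_erase h.2]
      · rintro ⟨I, j⟩ h
        simp only [Finset.mem_sigma, Finset.mem_powerset, Finset.mem_sdiff] at h ⊢
        have hjS : j ∈ S \ I := Finset.mem_sdiff.2 h.2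
        have hJ : S \ insert j I = (S \ I).erase j := Finset.sdiff_insert _ _ _
        rw [Finset.erase_insert h.2.2, hJ, ← neg_smul]
        congr 1
        have hjJ : j ∉ (S \ I).erase j := Finset.notMem_erase _ _
        have e1 : c I (S \ I) = c I ((S \ I).erase j) * (a j * ∏ i ∈ I, F j i) := by
          conv_lhs => rw [← Finset.insert_erase hjS]
          simp only [hc, Finset.prod_insert hjJ, Finset.prod_mul_distrib]; ring
        have e2 : c (insert j I) ((S \ I).erase j) =
            c I ((S \ I).erase j) * (d j * ∏ i ∈ (S \ I).erase j, F i j) := by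
          simp only [hc, Finset.prod_insert h.2.2]; ring
        rw [e1, e2]
        ring
    rw [hb m S hm, ih', map_sum]
    simp only [map_smul]
    rw [Finset.sum_congr rfl step, Finset.sum_add_distrib, Finset.sum_add_distrib,
      Finset.sum_powerset_insert hm, Finset.sum_add_distrib, cancel, add_neg_cancel, add_zero]

/-- Commuting operators `β i` generate a family `b(S) = ∏_{i ∈ S} β_i v`, independent of the order
of the factors. -/
theorem exists_betheVector {M : Type*} [AddCommGroup M] [Module ℂ M]
    (β : ι → M →ₗ[ℂ] M) (hβ : ∀ i j x, β i (β j x) = β j (β i x)) (v : M) :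
    ∃ b : Finset ι → M, b ∅ = v ∧ ∀ i S, i ∉ S → b (insert i S) = β i (b S) := by
  have hc : ∀ S : Finset ι, (S : Set ι).Pairwise (Function.onFun Commute fun i =>
      (β i : Module.End ℂ M)) := fun S i _ j _ _ => LinearMap.ext fun x => hβ i j x
  refine ⟨fun S => S.noncommProd (fun i => (β i : Module.End ℂ M)) (hc S) v, ?_, ?_⟩
  · simp
  · intro i S hi
    simp only [Finset.noncommProd_insert_of_notMem _ _ _ _ hi]
    rfl

/-- A family of Bethe vectors is computed by applying the operators in the order of any list. -/
theorem betheVector_toFinset {M : Type*} (β : ι → M → M) (b : Finset ι → M)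
    (hb : ∀ i S, i ∉ S → b (insert i S) = β i (b S)) (l : List ι) (hl : l.Nodup) :
    b l.toFinset = l.foldr β (b ∅) := by
  induction l with
  | nil => rfl
  | cons i l ih =>
    rw [List.nodup_cons] at hl
    rw [List.toFinset_cons, hb _ _ (by simpa using hl.1), ih hl.2, List.foldr_cons]

end BetheVectors

/-! ### The character of `ℤ / N` -/

section Character

variable {N : ℕ} {ω : ℂ}

/-- The character `n ↦ ω ^ n` of `ℤ / N`, for an `N`th root of unity `ω`. -/
def chr (ω : ℂ) (n : ZMod N) : ℂ := ω ^ n.val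

theorem chr_natCast (h : ω ^ N = 1) (m : ℕ) : chr ω (m : ZMod N) = ω ^ m := by
  rw [chr, ZMod.val_natCast]
  exact (pow_eq_pow_mod m h).symm

theorem chr_zero : chr ω (0 : ZMod N) = 1 := by simp [chr]

theorem chr_one (h : ω ^ N = 1) : chr ω (1 : ZMod N) = ω := by
  simpa using chr_natCast (N := N) h 1

variable [NeZero N]

theorem chr_add (h : ω ^ N = 1) (m n : ZMod N) : chr ω (m + n) = chr ω m * chr ω n := by
  conv_lhs => rw [← ZMod.natCast_zmod_val m, ← ZMod.natCast_zmod_val n]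
  rw [← Nat.cast_add, chr_natCast h, pow_add]
  rfl

theorem chr_neg_mul (h : ω ^ N = 1) (n : ZMod N) : chr ω (-n) * chr ω n = 1 := by
  rw [← chr_add h, neg_add_cancel, chr_zero]

theorem chr_mul (h : ω ^ N = 1) (m n : ZMod N) : chr ω (m * n) = chr ω m ^ n.val := by
  conv_lhs => rw [← ZMod.natCast_zmod_val m, ← ZMod.natCast_zmod_val n]
  rw [← Nat.cast_mul, chr_natCast h, pow_mul]
  rfl

theorem chr_ne_zero (h : ω ^ N = 1) (n : ZMod N) : chr ω n ≠ 0 :=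
  right_ne_zero_of_mul_eq_one (chr_neg_mul h n)

theorem chr_sub_one (h : ω ^ N = 1) (σ : ZMod N) : ω * chr ω (σ - 1) = chr ω σ := by
  have h1 := chr_add h 1 (σ - 1)
  rw [add_sub_cancel, chr_one h] at h1
  exact h1.symm

end Character

/-! ### Recursions of the Boltzmann weights -/

section Weights

variable {N : ℕ} [NeZero N] {ω : ℂ}

/-- A product `∏ c (ω ^ j)` over `1 ≤ j ≤ n` that is trivial over a full period obeys its
recursion on all of `ℤ / N`, including the step from `N - 1` to `0`. -/
theorem prod_Icc_val_add_one (h : ω ^ N = 1) (c : ℂ → ℂ)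
    (hc : ∏ j ∈ Finset.Icc 1 N, c (ω ^ j) = 1) (n : ZMod N) :
    ∏ j ∈ Finset.Icc 1 (n + 1).val, c (ω ^ j) =
      (∏ j ∈ Finset.Icc 1 n.val, c (ω ^ j)) * c (chr ω (n + 1)) := by
  have hn := ZMod.val_lt n
  -- The representative of `n + 1` is `n.val + 1`, except for `n = N - 1`.
  rcases (Nat.succ_le_of_lt hn).lt_or_eq with hlt | heq
  · have h1 : (n + 1).val = n.val + 1 := by
      conv_lhs => rw [← ZMod.natCast_zmod_val n]
      rw [← Nat.cast_one, ← Nat.cast_add, ZMod.val_natCast, Nat.mod_eq_of_lt hlt]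
    rw [h1, Finset.prod_Icc_succ_top (by omega), chr, h1]
  · have h1 : n + 1 = 0 := by
      conv_lhs => rw [← ZMod.natCast_zmod_val n]
      rw [← Nat.cast_one, ← Nat.cast_add, show n.val + 1 = N from heq, ZMod.natCast_self]
    rw [h1, chr_zero, ← h, ZMod.val_zero, Finset.Icc_eq_empty (by norm_num), Finset.prod_empty,
      ← hc]
    have := Finset.prod_Icc_succ_top (a := 1) (b := n.val) (by omega) (fun j => c (ω ^ j))
    rw [show n.val + 1 = N from heq] at this
    exact this

theorem prod_sub_mul_pow (hω : IsPrimitiveRoot ω N) (x y : ℂ) :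
    ∏ j ∈ Finset.Icc 1 N, (y - x * ω ^ j) = y ^ N - x ^ N := by
  have hN : 0 < N := Nat.pos_of_ne_zero (NeZero.ne N)
  rw [hω.pow_sub_pow_eq_prod_sub_mul y x hN]
  refine Finset.prod_bij (fun j _ => ω ^ j) ?_ ?_ ?_ ?_
  · intro j _
    rw [Polynomial.mem_nthRootsFinset hN, ← pow_mul, mul_comm, pow_mul, hω.pow_eq_one, one_pow]
  · intro i hi j hj hij
    rw [Finset.mem_Icc] at hi hj
    have h1 : ω ^ (i - 1) = ω ^ (j - 1) := by
      have hω0 : ω ≠ 0 := hω.ne_zero hN.ne'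
      apply mul_right_cancel₀ hω0
      rw [← pow_succ, ← pow_succ, Nat.sub_add_cancel hi.1, Nat.sub_add_cancel hj.1]
      exact hij
    have := hω.pow_inj (by omega) (by omega) h1
    omega
  · intro ζ hζ
    rw [Polynomial.mem_nthRootsFinset hN] at hζ
    obtain ⟨i, hi, rfl⟩ := hω.eq_pow_of_pow_eq_one hζ
    rcases Nat.eq_zero_or_pos i with rfl | h0
    · exact ⟨N, Finset.mem_Icc.2 ⟨hN, le_rfl⟩, by simp [hω.pow_eq_one]⟩
    · exact ⟨i, Finset.mem_Icc.2 ⟨h0, hi.le⟩, rfl⟩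
  · intro j _
    ring

/-- The curve equations make `W` well defined on `ℤ / N`. -/
theorem W_add_one (hω : IsPrimitiveRoot ω N) {k k' : ℂ} (hk : k ≠ 0) {p q : Rapidity}
    (hp : p.OnCurve N k k') (hq : q.OnCurve N k k')
    (hpq : ∀ m : ℕ, p.y ≠ q.x * ω ^ m) (n : ZMod N) :
    W ω p q (n + 1) * (q.μ * (p.y - q.x * chr ω (n + 1))) =
      W ω p q n * (p.μ * (q.y - p.x * chr ω (n + 1))) := by
  have hden : ∀ j : ℕ, p.y - q.x * ω ^ j ≠ 0 := fun j => sub_ne_zero.2 (hpq j)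
  have key := prod_Icc_val_add_one hω.pow_eq_one
    (fun u => p.μ / q.μ * ((q.y - p.x * u) / (p.y - q.x * u))) ?_ n
  · unfold W
    rw [key]
    have h1 : p.y - q.x * chr ω (n + 1) ≠ 0 := hden _
    have h2 := hq.1
    rw [mul_assoc]
    congr 1
    generalize p.y - q.x * chr ω (n + 1) = D at h1 ⊢
    field_simp
  · have hne : p.y ^ N - q.x ^ N ≠ 0 := by
      rw [← prod_sub_mul_pow hω]
      exact Finset.prod_ne_zero_iff.2 fun j _ => hden j
    simp only [Finset.prod_mul_distrib, Finset.prod_div_distrib, prod_sub_mul_pow hω,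
      Finset.prod_const, Nat.card_Icc, Nat.add_sub_cancel]
    obtain ⟨hp0, hpx, hpy⟩ := hp
    obtain ⟨hq0, hqx, hqy⟩ := hq
    have hp0' := pow_ne_zero N hp0
    have hq0' := pow_ne_zero N hq0
    rw [div_mul_div_comm, div_eq_one_iff_eq (mul_ne_zero hq0' hne)]
    rw [inv_pow] at hpx hqx
    apply mul_left_cancel₀ hk
    have e1 : k * (p.μ ^ N * (q.y ^ N - p.x ^ N)) =
        p.μ ^ N * ((1 - k' * q.μ ^ N) - (1 - k' * (p.μ ^ N)⁻¹)) := by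
      rw [← hpx, ← hqy]; ring
    have e2 : k * (q.μ ^ N * (p.y ^ N - q.x ^ N)) =
        q.μ ^ N * ((1 - k' * p.μ ^ N) - (1 - k' * (q.μ ^ N)⁻¹)) := by
      rw [← hpy, ← hqx]; ring
    rw [e1, e2]
    field_simp
    ring

/-- The curve equations make `W̄` well defined on `ℤ / N`. -/
theorem Wbar_add_one (hω : IsPrimitiveRoot ω N) {k k' : ℂ} (hk : k ≠ 0) {p q : Rapidity}
    (hp : p.OnCurve N k k') (hq : q.OnCurve N k k')
    (hpq : ∀ m : ℕ, q.y ≠ p.y * ω ^ m) (n : ZMod N) :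
    Wbar ω p q (n + 1) * (q.y - p.y * chr ω (n + 1)) =
      Wbar ω p q n * (p.μ * q.μ * (p.x * ω - q.x * chr ω (n + 1))) := by
  have hden : ∀ j : ℕ, q.y - p.y * ω ^ j ≠ 0 := fun j => sub_ne_zero.2 (hpq j)
  have key := prod_Icc_val_add_one hω.pow_eq_one
    (fun u => p.μ * q.μ * ((p.x * ω - q.x * u) / (q.y - p.y * u))) ?_ n
  · unfold Wbar
    rw [key]
    have h1 : q.y - p.y * chr ω (n + 1) ≠ 0 := hden _
    rw [mul_assoc]
    congr 1
    generalize q.y - p.y * chr ω (n + 1) = D at h1 ⊢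
    field_simp
  · have hne : q.y ^ N - p.y ^ N ≠ 0 := by
      rw [← prod_sub_mul_pow hω]
      exact Finset.prod_ne_zero_iff.2 fun j _ => hden j
    simp only [Finset.prod_mul_distrib, Finset.prod_div_distrib, prod_sub_mul_pow hω,
      Finset.prod_const, Nat.card_Icc, Nat.add_sub_cancel, mul_pow, hω.pow_eq_one, mul_one]
    obtain ⟨hp0, hpx, hpy⟩ := hp
    obtain ⟨hq0, hqx, hqy⟩ := hq
    have hp0' := pow_ne_zero N hp0
    have hq0' := pow_ne_zero N hq0
    rw [mul_div_assoc', div_eq_one_iff_eq hne]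
    rw [inv_pow] at hpx hqx
    apply mul_left_cancel₀ hk
    have e1 : k * (p.μ ^ N * q.μ ^ N * (p.x ^ N - q.x ^ N)) =
        p.μ ^ N * q.μ ^ N * ((1 - k' * (p.μ ^ N)⁻¹) - (1 - k' * (q.μ ^ N)⁻¹)) := by
      rw [← hpx, ← hqx]; ring
    have e2 : k * (q.y ^ N - p.y ^ N) = (1 - k' * q.μ ^ N) - (1 - k' * p.μ ^ N) := by
      rw [← hpy, ← hqy]; ring
    rw [e1, e2]
    field_simp
    ring

theorem What_eq (p q : Rapidity) (n : ZMod N) :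
    What ω p q n = ∑ m : ZMod N, chr ω (-(n * m)) * W ω p q m := rfl

/-- The recursion of `W` in Fourier space. -/
theorem What_sub_one (hω : IsPrimitiveRoot ω N) {k k' : ℂ} (hk : k ≠ 0) {p q : Rapidity}
    (hp : p.OnCurve N k k') (hq : q.OnCurve N k k')
    (hpq : ∀ m : ℕ, p.y ≠ q.x * ω ^ m) (n : ZMod N) :
    q.μ * (p.y * What ω p q n - q.x * What ω p q (n - 1)) =
      p.μ * (q.y * chr ω (-n) * What ω p q n
        - p.x * chr ω (-(n - 1)) * What ω p q (n - 1)) := by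
  have h := hω.pow_eq_one
  -- The shift `m ↦ m + 1` of the summation variable.
  have shift : ∀ r : ZMod N, chr ω (-r) * What ω p q r =
      ∑ m : ZMod N, chr ω (-(r * (m + 1))) * W ω p q m := by
    intro r
    rw [What_eq, Finset.mul_sum]
    refine Finset.sum_congr rfl fun m _ => ?_
    rw [← mul_assoc, ← chr_add h]
    congr 2; ring
  have plain : ∀ r : ZMod N, What ω p q r =
      ∑ m : ZMod N, chr ω (-(r * (m + 1))) * W ω p q (m + 1) := fun r =>
    (Equiv.sum_comp (Equiv.addRight (1 : ZMod N)) fun m => chr ω (-(r * m)) * W ω p q m).symm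
  rw [mul_assoc q.y, mul_assoc p.x, shift, shift, plain n, plain (n - 1)]
  simp only [Finset.mul_sum, ← Finset.sum_sub_distrib]
  refine Finset.sum_congr rfl fun m _ => ?_
  have e : chr ω (-((n - 1) * (m + 1))) = chr ω (-(n * (m + 1))) * chr ω (m + 1) := by
    rw [← chr_add h]; congr 1; ring
  rw [e]
  linear_combination chr ω (-(n * (m + 1))) * W_add_one hω hk hp hq hpq m

end Weights

/-! ### Weyl pairs and elementary intertwiners of cyclic `L`-operators -/

section Weyl

variable {N : ℕ} [NeZero N] {ω : ℂ} {𝒜 : Type*} [Ring 𝒜] [Algebra ℂ 𝒜]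

/-- A representation of the Weyl algebra `Z X = ω X Z`, `X ^ N = Z ^ N = 1` in `𝒜`, given by the
families of powers of `X` and of `Z`. -/
structure WeylPair (N : ℕ) [NeZero N] (ω : ℂ) (𝒜 : Type*) [Ring 𝒜] [Algebra ℂ 𝒜] where
  X : ZMod N → 𝒜
  Z : ZMod N → 𝒜
  X_zero : X 0 = 1
  X_add : ∀ m n, X (m + n) = X m * X n
  Z_zero : Z 0 = 1
  Z_add : ∀ m n, Z (m + n) = Z m * Z n
  Z_mul_X : ∀ m n, Z m * X n = chr ω (m * n) • (X n * Z m)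

/-- The image of a Weyl pair under an algebra homomorphism. -/
def WeylPair.map {ℬ : Type*} [Ring ℬ] [Algebra ℂ ℬ] (P : WeylPair N ω 𝒜) (f : 𝒜 →ₐ[ℂ] ℬ) :
    WeylPair N ω ℬ where
  X n := f (P.X n)
  Z n := f (P.Z n)
  X_zero := by rw [P.X_zero, map_one]
  X_add m n := by rw [P.X_add, map_mul]
  Z_zero := by rw [P.Z_zero, map_one]
  Z_add m n := by rw [P.Z_add, map_mul]
  Z_mul_X m n := by rw [← map_mul, P.Z_mul_X, map_smul, map_mul]

/-- The cyclic `L`-operator of a Weyl pair. -/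
def Lop (P : WeylPair N ω 𝒜) (p p' : Rapidity) (z : ℂ) : Matrix (Fin 2) (Fin 2) 𝒜 :=
  !![(-(p.y * p'.y * z)) • 1 + (p.μ * p'.μ) • P.Z 1,
      (-z) • ((p.y • 1 - (p'.x * p.μ * p'.μ) • P.Z 1) * P.X 1);
    P.X (-1) * (p'.y • 1 - (p.x * p.μ * p'.μ) • P.Z 1),
      1 - (p.x * p'.x * p.μ * p'.μ * z * ω) • P.Z 1]

theorem Lop_map {ℬ : Type*} [Ring ℬ] [Algebra ℂ ℬ] (P : WeylPair N ω 𝒜) (f : 𝒜 →ₐ[ℂ] ℬ)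
    (p p' : Rapidity) (z : ℂ) : Lop (P.map f) p p' z = (Lop P p p' z).map f := by
  ext i j
  fin_cases i <;> fin_cases j <;> simp [Lop, WeylPair.map]

theorem scalar_mul_comm {R : Type*} [Ring R] {φ : R} {M : Matrix (Fin 2) (Fin 2) R}
    (h : ∀ i j, Commute φ (M i j)) :
    Matrix.scalar (Fin 2) φ * M = M * Matrix.scalar (Fin 2) φ := by
  ext i j
  simpa [Matrix.scalar_apply] using (h i j).eq

/-- `∑ c(n) U ^ n`, for a family `U` of powers. -/
def powSum (U : ZMod N → 𝒜) (c : ZMod N → ℂ) : 𝒜 := ∑ n, c n • U n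

theorem powSum_mul_linear {U : ZMod N → 𝒜} (hU : ∀ m n, U (m + n) = U m * U n)
    (c : ZMod N → ℂ) (r t : ℂ) :
    powSum U c * (r • 1 - t • U 1) = powSum U fun n => r * c n - t * c (n - 1) := by
  have e : ∑ n, (t * c (n - 1)) • U n = ∑ n, (t * c n) • U (n + 1) := by
    rw [← Equiv.sum_comp (Equiv.addRight (1 : ZMod N))]
    simp
  simp only [powSum, sub_smul, Finset.sum_sub_distrib, e]
  rw [mul_sub, Finset.sum_mul, Finset.sum_mul]
  simp only [hU, smul_mul_smul_comm, mul_one, mul_comm]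

theorem linear_mul_powSum {U : ZMod N → 𝒜} (hU : ∀ m n, U (m + n) = U m * U n)
    (c : ZMod N → ℂ) (r t : ℂ) :
    (r • 1 - t • U 1) * powSum U c = powSum U fun n => r * c n - t * c (n - 1) := by
  rw [← powSum_mul_linear hU]
  refine Commute.sub_left (Commute.smul_left (Commute.one_left _) _) (Commute.smul_left ?_ _)
  exact Commute.sum_right _ _ _ fun n _ => Commute.smul_right (by
    rw [commute_iff_eq, ← hU, ← hU, add_comm]) _

theorem commute_powSum {U : ZMod N → 𝒜} {x : 𝒜} (h : ∀ n, Commute x (U n)) (c : ZMod N → ℂ) :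
    Commute x (powSum U c) :=
  Commute.sum_right _ _ _ fun n _ => (h n).smul_right _

/-- A Fourier series in `Z` whose coefficients obey the recursion of `W̄_{pq}` exchanges the two
rapidities of an `L`-operator. -/
theorem powSum_Z_mul_Lop (h : ω ^ N = 1) (P : WeylPair N ω 𝒜) (p q : Rapidity) (z : ℂ)
    (c : ZMod N → ℂ)
    (hc : ∀ n, c (n + 1) * (q.y - p.y * chr ω (n + 1)) =
      c n * (p.μ * q.μ * (p.x * ω - q.x * chr ω (n + 1)))) :
    Matrix.scalar (Fin 2) (powSum P.Z c) * Lop P p q z =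
      Lop P q p z * Matrix.scalar (Fin 2) (powSum P.Z c) := by
  set m := p.μ * q.μ with hm
  have hZ : ∀ n k, Commute (P.Z n) (P.Z k) := fun n k => by
    rw [commute_iff_eq, ← P.Z_add, ← P.Z_add, add_comm]
  set c' : ZMod N → ℂ := fun n => chr ω (-n) * c n with hc'
  -- Moving `Z ^ n` past `X⁻¹` twists the coefficient `c n` by `ω ^ (-n)`; the recursion of `c` makes
  -- up for this twist.
  have key : powSum P.Z c * (p.y • 1 - (q.x * m) • P.Z 1) =
      (q.y • 1 - (p.x * m) • P.Z 1) * powSum P.Z c' := by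
    rw [powSum_mul_linear P.Z_add, linear_mul_powSum P.Z_add]
    congr 1
    ext n
    have h1 := hc (n - 1)
    rw [sub_add_cancel] at h1
    have h2 : chr ω (-(n - 1)) = ω * chr ω (-n) := by
      rw [neg_sub, sub_eq_add_neg, chr_add h, chr_one h]
    simp only [hc', h2]
    linear_combination (-chr ω (-n)) * h1 -
      (p.y * c n - q.x * m * c (n - 1)) * chr_neg_mul h n
  have hX : P.X 1 * powSum P.Z c = powSum P.Z c' * P.X 1 := by
    simp only [powSum, Finset.mul_sum, Finset.sum_mul, smul_mul_assoc, mul_smul_comm, P.Z_mul_X,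
      smul_smul, hc']
    refine Finset.sum_congr rfl fun n _ => ?_
    rw [mul_one, mul_right_comm, chr_neg_mul h, one_mul]
  have hX' : powSum P.Z c * P.X (-1) = P.X (-1) * powSum P.Z c' := by
    simp only [powSum, Finset.mul_sum, Finset.sum_mul, smul_mul_assoc, mul_smul_comm, P.Z_mul_X,
      smul_smul, hc']
    refine Finset.sum_congr rfl fun n _ => ?_
    rw [mul_neg_one, mul_comm]
  have hcomm : ∀ (r t : ℂ) c, Commute (r • (1 : 𝒜) - t • P.Z 1) (powSum P.Z c) := fun r t c =>
    commute_powSum (fun n => ((Commute.one_left _).smul_left _).sub_left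
      ((hZ _ _).smul_left _)) c
  have hcZ : Commute (P.Z 1) (powSum P.Z c) := commute_powSum (fun n => hZ _ _) c
  ext i j
  fin_cases i <;> fin_cases j
  · simp only [Lop, Matrix.scalar_apply, Matrix.diagonal_mul, Matrix.mul_diagonal]
    simp [mul_add, add_mul, hcZ.eq, mul_comm p.y, mul_comm p.μ]
  · simp only [Lop, Matrix.scalar_apply, Matrix.diagonal_mul, Matrix.mul_diagonal]
    simp only [Matrix.of_apply, Matrix.cons_val', Matrix.cons_val_zero, Matrix.cons_val_one,
      Fin.zero_eta, Fin.mk_one, Fin.isValue, mul_smul_comm, smul_mul_assoc]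
    rw [mul_assoc q.x, ← hm, mul_assoc p.x, mul_comm q.μ, ← hm, ← mul_assoc, key, mul_assoc,
      ← hX, mul_assoc]
  · simp only [Lop, Matrix.scalar_apply, Matrix.diagonal_mul, Matrix.mul_diagonal]
    simp only [Matrix.of_apply, Matrix.cons_val', Matrix.cons_val_zero, Matrix.cons_val_one,
      Fin.zero_eta, Fin.mk_one, Fin.isValue]
    rw [mul_assoc q.x, mul_assoc p.x, mul_comm q.μ, ← hm, ← mul_assoc, hX', mul_assoc,
      ← (hcomm _ _ _).eq, ← key, mul_assoc, (hcomm _ _ _).eq]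
  · simp only [Lop, Matrix.scalar_apply, Matrix.diagonal_mul, Matrix.mul_diagonal]
    simp [mul_sub, sub_mul, hcZ.eq, mul_comm p.x, mul_right_comm _ p.μ q.μ]

/-- Left factor of the `L`-operator; it involves only `X` and the first rapidity. -/
def colFactor (P : WeylPair N ω 𝒜) (p : Rapidity) (z : ℂ) : Matrix (Fin 2) (Fin 2) 𝒜 :=
  !![(-(z * p.y)) • 1, 1; P.X (-1), (-p.x) • P.X (-1)]

/-- Right factor of the `L`-operator; it involves only `X` and the second rapidity. -/
def rowFactor (P : WeylPair N ω 𝒜) (p : Rapidity) (z : ℂ) : Matrix (Fin 2) (Fin 2) 𝒜 :=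
  !![p.y • 1, P.X 1; 1, (z * p.x) • P.X 1]

/-- Middle factor of the `L`-operator; it involves only `Z`. -/
def midFactor (P : WeylPair N ω 𝒜) (m : ℂ) : Matrix (Fin 2) (Fin 2) 𝒜 :=
  !![1, 0; 0, m • P.Z 1]

/-- The `L`-operator factorizes so that each rapidity, apart from `μ`, appears in one outer factor. -/
theorem Lop_eq_mul (h : ω ^ N = 1) (P : WeylPair N ω 𝒜) (p p' : Rapidity) (z : ℂ) :
    Lop P p p' z = colFactor P p z * midFactor P (p.μ * p'.μ) * rowFactor P p' z := by
  have h1 : P.X (-1) * P.X 1 = 1 := by rw [← P.X_add, neg_add_cancel, P.X_zero]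
  have h2 : P.X (-1) * P.Z 1 * P.X 1 = ω • P.Z 1 := by
    rw [mul_assoc, P.Z_mul_X, mul_smul_comm, ← mul_assoc, h1, mul_one, chr_one h, one_mul]
  simp only [colFactor, midFactor, rowFactor, Matrix.mul_fin_two, Lop]
  ext i j
  fin_cases i <;> fin_cases j
  · simp [smul_smul]; module
  · simp [smul_smul, sub_mul]; module
  · simp [smul_smul, mul_sub]; module
  · simp [smul_smul, h1, h2]; module

/-- A Fourier series in `X₁ X₂⁻¹` whose coefficients obey the recursion of the Fourier transform of
`W_{rs}` exchanges the two inner rapidities of a product of two `L`-operators. -/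
theorem powSum_X_mul_Lop (h : ω ^ N = 1) (P₁ P₂ : WeylPair N ω 𝒜)
    (hXX : ∀ m n, Commute (P₁.X m) (P₂.X n)) (hXZ : ∀ m n, Commute (P₁.X m) (P₂.Z n))
    (hZX : ∀ m n, Commute (P₁.Z m) (P₂.X n))
    (p r s q : Rapidity) (z : ℂ) (c : ZMod N → ℂ)
    (hc : ∀ n, s.μ * (r.y * c n - s.x * c (n - 1)) =
      r.μ * (s.y * chr ω (-n) * c n - r.x * chr ω (-(n - 1)) * c (n - 1))) :
    Matrix.scalar (Fin 2) (powSum (fun n => P₁.X n * P₂.X (-n)) c) * (Lop P₁ p r z * Lop P₂ s q z) =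
      Lop P₁ p s z * Lop P₂ r q z *
        Matrix.scalar (Fin 2) (powSum (fun n => P₁.X n * P₂.X (-n)) c) := by
  set U : ZMod N → 𝒜 := fun n => P₁.X n * P₂.X (-n) with hUdef
  have hU : ∀ m n, U (m + n) = U m * U n := fun m n => by
    simp only [hUdef, neg_add, P₁.X_add, P₂.X_add]
    rw [mul_assoc, ← mul_assoc (P₁.X n), (hXX n (-m)).eq]
    simp only [mul_assoc]
  have hX1 : ∀ m n, Commute (P₁.X m) (U n) := fun m n =>
    Commute.mul_right (by rw [commute_iff_eq, ← P₁.X_add, ← P₁.X_add, add_comm]) (hXX _ _)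
  have hX2 : ∀ m n, Commute (P₂.X m) (U n) := fun m n =>
    Commute.mul_right (hXX _ _).symm (by rw [commute_iff_eq, ← P₂.X_add, ← P₂.X_add, add_comm])
  set φ := powSum U c with hφ
  have hX1φ : ∀ m, Commute φ (P₁.X m) := fun m => (commute_powSum (hX1 m) c).symm
  have hX2φ : ∀ m, Commute φ (P₂.X m) := fun m => (commute_powSum (hX2 m) c).symm
  have hcol : Matrix.scalar (Fin 2) φ * colFactor P₁ p z =
      colFactor P₁ p z * Matrix.scalar (Fin 2) φ := by
    refine scalar_mul_comm fun i j => ?_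
    fin_cases i <;> fin_cases j <;>
      simp [colFactor, hX1φ, (hX1φ _).smul_right, Commute.smul_right]
  have hrow : Matrix.scalar (Fin 2) φ * rowFactor P₂ q z =
      rowFactor P₂ q z * Matrix.scalar (Fin 2) φ := by
    refine scalar_mul_comm fun i j => ?_
    fin_cases i <;> fin_cases j <;>
      simp [rowFactor, hX2φ, (hX2φ _).smul_right, Commute.smul_right]
  set c' : ZMod N → ℂ := fun n => chr ω (-n) * c n with hc'
  set φ' := powSum U c' with hφ'
  -- Moving `φ` past `Z₁` or `Z₂` twists its coefficients by `ω ^ (-n)`; the recursion of `c` says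
  -- that `φ` and the twisted series `φ'` agree up to linear factors in `U`.
  have key : φ * ((s.μ * r.y) • 1 - (s.μ * s.x) • U 1) =
      ((r.μ * s.y) • 1 - (r.μ * r.x) • U 1) * φ' := by
    rw [hφ, hφ', powSum_mul_linear hU, linear_mul_powSum hU]
    congr 1
    ext n
    simp only [hc']
    linear_combination hc n
  have hZ2U : ∀ n, P₂.Z 1 * U n = chr ω (-n) • (U n * P₂.Z 1) := fun n => by
    rw [hUdef]
    simp only
    rw [← mul_assoc, ← (hXZ _ _).eq, mul_assoc, P₂.Z_mul_X, mul_smul_comm, one_mul, mul_assoc]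
  have hZ1U : ∀ n, P₁.Z 1 * U n = chr ω n • (U n * P₁.Z 1) := fun n => by
    rw [hUdef]
    simp only
    rw [← mul_assoc, P₁.Z_mul_X, smul_mul_assoc, mul_assoc, (hZX _ _).eq, one_mul, mul_assoc]
  have hZ2 : P₂.Z 1 * φ = φ' * P₂.Z 1 := by
    simp only [hφ, hφ', powSum, Finset.mul_sum, Finset.sum_mul, smul_mul_assoc, mul_smul_comm,
      hZ2U, smul_smul, hc', mul_comm]
  have hZ1 : φ * P₁.Z 1 = P₁.Z 1 * φ' := by
    simp only [hφ, hφ', powSum, Finset.mul_sum, Finset.sum_mul, smul_mul_assoc, mul_smul_comm,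
      hZ1U, smul_smul, hc']
    refine Finset.sum_congr rfl fun n _ => ?_
    rw [mul_right_comm, chr_neg_mul h, one_mul]
  have hlin : ∀ (r t : ℂ) c, Commute (r • (1 : 𝒜) - t • U 1) (powSum U c) := fun r t c =>
    commute_powSum (fun n => ((Commute.one_left _).smul_left _).sub_left
      (Commute.smul_left (by rw [commute_iff_eq, ← hU, ← hU, add_comm]) _)) c
  have hmid : ∀ a b : Rapidity, rowFactor P₁ a z * colFactor P₂ b z =
      !![(-(z * a.y * b.y)) • 1 - (-1 : ℂ) • U 1, a.y • 1 - b.x • U 1;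
        (-z) • (b.y • 1 - a.x • U 1), (1 : ℂ) • 1 - (z * a.x * b.x) • U 1] := by
    intro a b
    simp only [rowFactor, colFactor, Matrix.mul_fin_two, hUdef]
    ext i j
    fin_cases i <;> fin_cases j <;> simp [smul_smul] <;> module
  have hlinφ : ∀ r t : ℂ, Commute (r • (1 : 𝒜) - t • U 1) φ := fun r t => hlin r t c
  have hlinφ' : ∀ r t : ℂ, Commute (r • (1 : 𝒜) - t • U 1) φ' := fun r t => hlin r t c'
  clear_value U φ φ'
  -- The outer factors of the two `L`-operators commute with `φ`, so only the inner product matters.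
  have inner : Matrix.scalar (Fin 2) φ * (midFactor P₁ (p.μ * r.μ) *
        (rowFactor P₁ r z * colFactor P₂ s z) * midFactor P₂ (s.μ * q.μ)) =
      midFactor P₁ (p.μ * s.μ) * (rowFactor P₁ s z * colFactor P₂ r z) *
        midFactor P₂ (r.μ * q.μ) * Matrix.scalar (Fin 2) φ := by
    rw [hmid, hmid]
    simp only [midFactor, Matrix.mul_fin_two]
    have key1 : s.μ • (φ * (r.y • 1 - s.x • U 1)) = r.μ • ((s.y • 1 - r.x • U 1) * φ') := by
      rw [← mul_smul_comm, ← smul_mul_assoc]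
      simpa only [smul_sub, smul_smul] using key
    ext i j
    fin_cases i <;> fin_cases j
    · simp only [Matrix.scalar_apply, Matrix.diagonal_mul, Matrix.mul_diagonal]
      simp only [Matrix.of_apply, Matrix.cons_val', Matrix.cons_val_zero,
        Fin.zero_eta, Fin.isValue, one_mul, mul_one, zero_mul, mul_zero, add_zero]
      rw [(hlinφ _ _).eq, mul_right_comm z]
    · simp only [Matrix.scalar_apply, Matrix.diagonal_mul, Matrix.mul_diagonal]
      simp only [Matrix.of_apply, Matrix.cons_val', Matrix.cons_val_zero, Matrix.cons_val_one,
        Fin.zero_eta, Fin.mk_one, Fin.isValue, one_mul, zero_mul, mul_zero, add_zero, zero_add]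
      have e : s.μ • (φ * ((r.y • 1 - s.x • U 1) * P₂.Z 1)) =
          r.μ • ((s.y • 1 - r.x • U 1) * P₂.Z 1 * φ) := by
        rw [mul_assoc _ _ φ, hZ2, ← mul_assoc, ← mul_assoc, ← smul_mul_assoc, key1,
          smul_mul_assoc]
      simp only [smul_mul_assoc, mul_smul_comm]
      rw [mul_comm s.μ, mul_comm r.μ, mul_smul, mul_smul, e]
    · simp only [Matrix.scalar_apply, Matrix.diagonal_mul, Matrix.mul_diagonal]
      simp only [Matrix.of_apply, Matrix.cons_val', Matrix.cons_val_zero, Matrix.cons_val_one,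
        Fin.zero_eta, Fin.mk_one, Fin.isValue, mul_one, zero_mul, mul_zero, add_zero, zero_add]
      have e : r.μ • (φ * (P₁.Z 1 * (s.y • 1 - r.x • U 1))) =
          s.μ • (P₁.Z 1 * (r.y • 1 - s.x • U 1) * φ) := by
        rw [← mul_assoc, hZ1, mul_assoc, mul_assoc, ← (hlinφ' _ _).eq, (hlinφ _ _).eq,
          ← mul_smul_comm r.μ (P₁.Z 1), ← mul_smul_comm s.μ (P₁.Z 1), key1]
      simp only [smul_mul_assoc, mul_smul_comm]
      rw [mul_smul, mul_smul, e]
    · simp only [Matrix.scalar_apply, Matrix.diagonal_mul, Matrix.mul_diagonal]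
      simp only [Matrix.of_apply, Matrix.cons_val', Matrix.cons_val_zero, Matrix.cons_val_one,
        Fin.mk_one, Fin.isValue, mul_one, zero_mul, mul_zero, add_zero, zero_add]
      have e : φ * (P₁.Z 1 * ((1 : ℂ) • 1 - (z * r.x * s.x) • U 1) * P₂.Z 1) =
          P₁.Z 1 * ((1 : ℂ) • 1 - (z * s.x * r.x) • U 1) * P₂.Z 1 * φ := by
        rw [mul_assoc _ (P₂.Z 1) φ, hZ2, ← mul_assoc _ φ', mul_assoc _ _ φ', (hlinφ' _ _).eq,
          mul_assoc (P₁.Z 1), ← mul_assoc φ, hZ1, mul_right_comm z]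
        simp only [mul_assoc]
      simp only [smul_mul_assoc, mul_smul_comm, e, smul_smul]
      congr 1
      ring
  simp only [Lop_eq_mul h]
  calc _ = Matrix.scalar (Fin 2) φ * colFactor P₁ p z * (midFactor P₁ (p.μ * r.μ) *
        (rowFactor P₁ r z * colFactor P₂ s z) * midFactor P₂ (s.μ * q.μ)) * rowFactor P₂ q z := by
        simp only [mul_assoc]
    _ = colFactor P₁ p z * (Matrix.scalar (Fin 2) φ * (midFactor P₁ (p.μ * r.μ) *
        (rowFactor P₁ r z * colFactor P₂ s z) * midFactor P₂ (s.μ * q.μ))) * rowFactor P₂ q z := by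
        rw [hcol]; simp only [mul_assoc]
    _ = colFactor P₁ p z * (midFactor P₁ (p.μ * s.μ) * (rowFactor P₁ s z * colFactor P₂ r z) *
        midFactor P₂ (r.μ * q.μ)) * (Matrix.scalar (Fin 2) φ * rowFactor P₂ q z) := by
        rw [inner]; simp only [mul_assoc]
    _ = _ := by rw [hrow]; simp only [mul_assoc]

end Weyl

/-! ### Weyl pairs on one and two local spaces -/

section Standard

variable {N : ℕ} [NeZero N] {ω : ℂ}

/-- The Weyl pair of the local space. -/
def stdPair (h : ω ^ N = 1) : WeylPair N ω (Matrix (ZMod N) (ZMod N) ℂ) where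
  X := Xop
  Z := Zop ω
  X_zero := by ext a b; simp [Xop, Matrix.one_apply]
  X_add m n := by
    ext a b
    simp only [Xop, Matrix.mul_apply, Matrix.of_apply, mul_ite, mul_one, mul_zero,
      Finset.sum_ite_eq', Finset.mem_univ, if_true]
    congr 1
    rw [add_assoc, add_comm n m]
  Z_zero := by ext a b; simp [Zop, Matrix.one_apply, Matrix.diagonal_apply]
  Z_add m n := by
    simp only [Zop, Matrix.diagonal_mul_diagonal]
    congr 1
    ext σ
    change chr ω σ ^ (m + n).val = chr ω σ ^ m.val * chr ω σ ^ n.val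
    rw [← chr_mul h, ← chr_mul h, ← chr_mul h, mul_add, chr_add h]
  Z_mul_X m n := by
    ext a b
    simp only [Zop, Xop, Matrix.diagonal_mul, Matrix.smul_apply, Matrix.mul_diagonal,
      Matrix.of_apply, smul_eq_mul]
    change chr ω a ^ m.val * _ = chr ω (m * n) * (_ * chr ω b ^ m.val)
    rw [← chr_mul h, ← chr_mul h]
    split_ifs with hab
    · rw [hab, mul_one, one_mul, ← chr_add h]
      congr 1
      ring
    · simp

theorem cyclicL_eq (h : ω ^ N = 1) (p p' : Rapidity) (z : ℂ) :
    cyclicL ω p p' z = Lop (stdPair (N := N) h) p p' z := rfl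

/-- `M ↦ M ⊗ 1`. -/
def kronLeft (N : ℕ) [NeZero N] :
    Matrix (ZMod N) (ZMod N) ℂ →ₐ[ℂ] Matrix (ZMod N × ZMod N) (ZMod N × ZMod N) ℂ where
  toFun M := M ⊗ₖ 1
  map_one' := Matrix.one_kronecker_one
  map_mul' M M' := by rw [← Matrix.mul_kronecker_mul, mul_one]
  map_zero' := Matrix.zero_kronecker _
  map_add' M M' := Matrix.add_kronecker _ _ _
  commutes' r := by
    rw [Algebra.algebraMap_eq_smul_one, Algebra.algebraMap_eq_smul_one, Matrix.smul_kronecker,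
      Matrix.one_kronecker_one]

/-- `M ↦ 1 ⊗ M`. -/
def kronRight (N : ℕ) [NeZero N] :
    Matrix (ZMod N) (ZMod N) ℂ →ₐ[ℂ] Matrix (ZMod N × ZMod N) (ZMod N × ZMod N) ℂ where
  toFun M := 1 ⊗ₖ M
  map_one' := Matrix.one_kronecker_one
  map_mul' M M' := by rw [← Matrix.mul_kronecker_mul, mul_one]
  map_zero' := Matrix.kronecker_zero _
  map_add' M M' := Matrix.kronecker_add _ _ _
  commutes' r := by
    rw [Algebra.algebraMap_eq_smul_one, Algebra.algebraMap_eq_smul_one, Matrix.kronecker_smul,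
      Matrix.one_kronecker_one]

theorem kronLeft_apply (M : Matrix (ZMod N) (ZMod N) ℂ) : kronLeft N M = M ⊗ₖ 1 := rfl

theorem kronRight_apply (M : Matrix (ZMod N) (ZMod N) ℂ) : kronRight N M = 1 ⊗ₖ M := rfl

theorem kronLeft_mul_kronRight (M M' : Matrix (ZMod N) (ZMod N) ℂ) :
    kronLeft N M * kronRight N M' = M ⊗ₖ M' := by
  rw [kronLeft_apply, kronRight_apply, ← Matrix.mul_kronecker_mul, mul_one, one_mul]

theorem commute_kron (M M' : Matrix (ZMod N) (ZMod N) ℂ) :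
    Commute (kronLeft N M) (kronRight N M') := by
  rw [commute_iff_eq, kronLeft_mul_kronRight, kronLeft_apply, kronRight_apply,
    ← Matrix.mul_kronecker_mul, mul_one, one_mul]

theorem permOp_mul_kronLeft (M : Matrix (ZMod N) (ZMod N) ℂ) :
    permOp N * kronLeft N M = kronRight N M * permOp N := by
  ext ⟨a, b⟩ ⟨c, d⟩
  simp only [kronLeft_apply, kronRight_apply, Matrix.mul_apply, permOp, Matrix.of_apply,
    Matrix.kroneckerMap_apply, Fintype.sum_prod_type, Prod.swap_prod_mk, Prod.mk.injEq,
    Matrix.one_apply, ite_and, ite_mul, one_mul, zero_mul, mul_ite, mul_one, mul_zero,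
    Finset.sum_ite_eq', Finset.mem_univ, if_true]
  split_ifs <;> simp

theorem permOp_mul_kronRight (M : Matrix (ZMod N) (ZMod N) ℂ) :
    permOp N * kronRight N M = kronLeft N M * permOp N := by
  ext ⟨a, b⟩ ⟨c, d⟩
  simp only [kronLeft_apply, kronRight_apply, Matrix.mul_apply, permOp, Matrix.of_apply,
    Matrix.kroneckerMap_apply, Fintype.sum_prod_type, Prod.swap_prod_mk, Prod.mk.injEq,
    Matrix.one_apply, ite_and, ite_mul, one_mul, zero_mul, mul_ite, mul_one, mul_zero,
    Finset.sum_ite_eq', Finset.mem_univ, if_true]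
  rw [Finset.sum_eq_single c (fun x _ hx => by simp [hx]) (by simp)]
  simp

end Standard

/-! ### The Yang–Baxter relation of `S` -/

section SOperator

variable {N : ℕ} [NeZero N] {ω : ℂ}

/-- `S(p, p'; q, q')` is the permutation composed with the four elementary intertwiners, each of
which is a Fourier series in one unitary. -/
theorem S_eq_mul (p p' q q' : Rapidity) :
    S ω p p' q q' = (1 / (N : ℂ) ^ 2) • (permOp N *
      (powSum (fun n => kronLeft N (Xop n) * kronRight N (Xop (-n))) (What ω p q') *
        powSum (fun n => kronLeft N (Zop ω n)) (Wbar ω p q) *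
        powSum (fun n => kronRight N (Zop ω n)) (Wbar ω p' q') *
        powSum (fun n => kronLeft N (Xop n) * kronRight N (Xop (-n))) (What ω p' q))) := by
  unfold S
  congr 2
  have e : ∀ n₁ n₂ n₃ n₄ : ZMod N, w ω p p' q q' n₁ n₂ n₃ n₄ •
      ((Xop n₁ * Zop ω n₂ * Xop n₄) ⊗ₖ (Xop (-n₁) * Zop ω n₃ * Xop (-n₄))) =
      What ω p q' n₁ • (kronLeft N (Xop n₁) * kronRight N (Xop (-n₁))) *
        Wbar ω p q n₂ • kronLeft N (Zop ω n₂) * Wbar ω p' q' n₃ • kronRight N (Zop ω n₃) *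
        What ω p' q n₄ • (kronLeft N (Xop n₄) * kronRight N (Xop (-n₄))) := by
    intro n₁ n₂ n₃ n₄
    simp only [smul_mul_assoc, mul_smul_comm, smul_smul]
    rw [← kronLeft_mul_kronRight, map_mul, map_mul, map_mul, map_mul]
    congr 1
    · simp only [w]; ring
    · generalize kronLeft N (Xop n₁) = a
      rw [mul_assoc a (kronRight N _) (kronLeft N _), ← (commute_kron _ _).eq]
      simp only [mul_assoc]
      congr 2
      rw [← mul_assoc (kronLeft N (Xop n₄)), (commute_kron (Xop n₄) _).eq, mul_assoc,
        ← mul_assoc (kronLeft N (Xop n₄)), (commute_kron (Xop n₄) _).eq]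
      simp only [mul_assoc]
  simp only [e, powSum, ← Finset.mul_sum, ← Finset.sum_mul]

/-- The Yang–Baxter relation between `S` and two cyclic `L`-operators: `S` intertwines the two
orders in which the `L`-operators of its two factors can be multiplied. -/
theorem S_mul_cyclicL {k k' : ℂ} (hω : IsPrimitiveRoot ω N) (hk : k ≠ 0) {p p' q q' : Rapidity}
    (hp : p.OnCurve N k k') (hp' : p'.OnCurve N k k') (hq : q.OnCurve N k k')
    (hq' : q'.OnCurve N k k') (h₁ : ∀ m : ℕ, p.y ≠ q'.x * ω ^ m) (h₂ : ∀ m : ℕ, q.y ≠ p.y * ω ^ m)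
    (h₃ : ∀ m : ℕ, q'.y ≠ p'.y * ω ^ m) (h₄ : ∀ m : ℕ, p'.y ≠ q.x * ω ^ m) (z : ℂ) :
    Matrix.scalar (Fin 2) (S ω p p' q q') *
        ((cyclicL ω p p' z).map (kronLeft N) * (cyclicL ω q q' z).map (kronRight N)) =
      (cyclicL ω q q' z).map (kronRight N) * (cyclicL ω p p' z).map (kronLeft N) *
        Matrix.scalar (Fin 2) (S ω p p' q q') := by
  have h := hω.pow_eq_one
  set P₁ := (stdPair (N := N) h).map (kronLeft N) with hP₁
  set P₂ := (stdPair (N := N) h).map (kronRight N) with hP₂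
  have e₁ : ∀ a b, (cyclicL ω a b z).map (kronLeft N) = Lop P₁ a b z := fun a b => by
    rw [cyclicL_eq h, hP₁, Lop_map]
  have e₂ : ∀ a b, (cyclicL ω a b z).map (kronRight N) = Lop P₂ a b z := fun a b => by
    rw [cyclicL_eq h, hP₂, Lop_map]
  have hWX : ∀ (p r s q : Rapidity), r.OnCurve N k k' → s.OnCurve N k k' →
      (∀ m : ℕ, r.y ≠ s.x * ω ^ m) → _ := fun p r s q hr hs hrs =>
    powSum_X_mul_Lop h P₁ P₂ (fun m n => commute_kron _ _) (fun m n => commute_kron _ _)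
      (fun m n => commute_kron _ _) p r s q z (What ω r s) (What_sub_one hω hk hr hs hrs)
  have hZ₁ := powSum_Z_mul_Lop h P₁ p q z (Wbar ω p q) (Wbar_add_one hω hk hp hq h₂)
  have hZ₂ := powSum_Z_mul_Lop h P₂ p' q' z (Wbar ω p' q') (Wbar_add_one hω hk hp' hq' h₃)
  have hc₁ : Matrix.scalar (Fin 2) (powSum P₂.Z (Wbar ω p' q')) * Lop P₁ p q z =
      Lop P₁ p q z * Matrix.scalar (Fin 2) (powSum P₂.Z (Wbar ω p' q')) := by
    rw [← e₁]
    exact scalar_mul_comm fun i j => (commute_powSum (fun n => commute_kron _ _) _).symm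
  have hc₂ : Matrix.scalar (Fin 2) (powSum P₁.Z (Wbar ω p q)) * Lop P₂ q' p' z =
      Lop P₂ q' p' z * Matrix.scalar (Fin 2) (powSum P₁.Z (Wbar ω p q)) := by
    rw [← e₂]
    exact scalar_mul_comm fun i j => (commute_powSum (fun n => (commute_kron _ _).symm) _).symm
  have hperm : Matrix.scalar (Fin 2) (permOp N) * (Lop P₁ q q' z * Lop P₂ p p' z) =
      Lop P₂ q q' z * Lop P₁ p p' z * Matrix.scalar (Fin 2) (permOp N) := by
    have l : Matrix.scalar (Fin 2) (permOp N) * Lop P₁ q q' z =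
        Lop P₂ q q' z * Matrix.scalar (Fin 2) (permOp N) := by
      rw [← e₁, ← e₂]
      ext1 i j
      simpa [Matrix.scalar_apply] using permOp_mul_kronLeft _
    have r : Matrix.scalar (Fin 2) (permOp N) * Lop P₂ p p' z =
        Lop P₁ p p' z * Matrix.scalar (Fin 2) (permOp N) := by
      rw [← e₁, ← e₂]
      ext1 i j
      simpa [Matrix.scalar_apply] using permOp_mul_kronRight _
    rw [← mul_assoc, l, mul_assoc, r, mul_assoc]
  have hS : Matrix.scalar (Fin 2) (S ω p p' q q') = (1 / (N : ℂ) ^ 2) •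
      (Matrix.scalar (Fin 2) (permOp N) *
        (Matrix.scalar (Fin 2) (powSum (fun n => P₁.X n * P₂.X (-n)) (What ω p q')) *
        Matrix.scalar (Fin 2) (powSum P₁.Z (Wbar ω p q)) *
        Matrix.scalar (Fin 2) (powSum P₂.Z (Wbar ω p' q')) *
        Matrix.scalar (Fin 2) (powSum (fun n => P₁.X n * P₂.X (-n)) (What ω p' q)))) := by
    rw [S_eq_mul, ← map_mul, ← map_mul, ← map_mul, ← map_mul]
    ext1 i j
    simp only [Matrix.scalar_apply, Matrix.smul_apply, Matrix.diagonal_apply]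
    split_ifs
    · simp; rfl
    · simp
  have hX₁ := hWX q p q' p' hp hq' h₁
  have hX₂ := hWX p p' q q' hp' hq h₄
  rw [e₁, e₂, hS, smul_mul_assoc, mul_smul_comm]
  congr 1
  generalize Matrix.scalar (Fin 2) (powSum (fun n => P₁.X n * P₂.X (-n)) (What ω p q')) = f₁ at *
  generalize Matrix.scalar (Fin 2) (powSum P₁.Z (Wbar ω p q)) = f₂ at *
  generalize Matrix.scalar (Fin 2) (powSum P₂.Z (Wbar ω p' q')) = f₃ at *
  generalize Matrix.scalar (Fin 2) (powSum (fun n => P₁.X n * P₂.X (-n)) (What ω p' q)) = f₄ at *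
  -- Starting with `f₄`, the factors reorder the rapidities as
  -- `p p' q q' → p q p' q' → q p q' p' → q q' p p'`; the permutation swaps the two spaces.
  calc _ = Matrix.scalar (Fin 2) (permOp N) * (f₁ * (f₂ * (f₃ *
        (f₄ * (Lop P₁ p p' z * Lop P₂ q q' z))))) := by simp only [mul_assoc]
    _ = Matrix.scalar (Fin 2) (permOp N) * (f₁ * (f₂ * (f₃ * Lop P₁ p q z) * Lop P₂ p' q' z)) *
        f₄ := by rw [hX₂]; simp only [mul_assoc]
    _ = Matrix.scalar (Fin 2) (permOp N) * (f₁ * (f₂ * Lop P₁ p q z * (f₃ * Lop P₂ p' q' z))) *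
        f₄ := by rw [hc₁]; simp only [mul_assoc]
    _ = Matrix.scalar (Fin 2) (permOp N) * (f₁ * (Lop P₁ q p z * (f₂ * Lop P₂ q' p' z))) * f₃ *
        f₄ := by rw [hZ₁, hZ₂]; simp only [mul_assoc]
    _ = Matrix.scalar (Fin 2) (permOp N) * (f₁ * (Lop P₁ q p z * Lop P₂ q' p' z)) * f₂ * f₃ *
        f₄ := by rw [hc₂]; simp only [mul_assoc]
    _ = Matrix.scalar (Fin 2) (permOp N) * (Lop P₁ q q' z * Lop P₂ p p' z) * f₁ * f₂ * f₃ *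
        f₄ := by rw [hX₁]; simp only [mul_assoc]
    _ = _ := by rw [hperm]; simp only [mul_assoc]

end SOperator

/-! ### Exchange relations -/

section RTT

variable {𝒜 : Type*} [Ring 𝒜]

/-- `T ⊗ 1` on the product of two auxiliary spaces `ℂ²`. -/
def leftLeg (T : Matrix (Fin 2) (Fin 2) 𝒜) : Matrix (Fin 2 × Fin 2) (Fin 2 × Fin 2) 𝒜 :=
  Matrix.of fun a b => if a.2 = b.2 then T a.1 b.1 else 0

/-- `1 ⊗ T` on the product of two auxiliary spaces `ℂ²`. -/
def rightLeg (T : Matrix (Fin 2) (Fin 2) 𝒜) : Matrix (Fin 2 × Fin 2) (Fin 2 × Fin 2) 𝒜 :=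
  Matrix.of fun a b => if a.1 = b.1 then T a.2 b.2 else 0

theorem leftLeg_one : leftLeg (1 : Matrix (Fin 2) (Fin 2) 𝒜) = 1 := by
  ext ⟨a, b⟩ ⟨c, d⟩
  simp only [leftLeg, Matrix.of_apply, Matrix.one_apply, Prod.mk.injEq]
  split_ifs <;> simp_all

theorem rightLeg_one : rightLeg (1 : Matrix (Fin 2) (Fin 2) 𝒜) = 1 := by
  ext ⟨a, b⟩ ⟨c, d⟩
  simp only [rightLeg, Matrix.of_apply, Matrix.one_apply, Prod.mk.injEq]
  split_ifs <;> simp_all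

theorem leftLeg_mul (T S : Matrix (Fin 2) (Fin 2) 𝒜) :
    leftLeg (T * S) = leftLeg T * leftLeg S := by
  ext ⟨a, b⟩ ⟨c, d⟩
  simp [leftLeg, Matrix.mul_apply, Fintype.sum_prod_type, ite_mul, mul_ite]

theorem rightLeg_mul (T S : Matrix (Fin 2) (Fin 2) 𝒜) :
    rightLeg (T * S) = rightLeg T * rightLeg S := by
  ext ⟨a, b⟩ ⟨c, d⟩
  fin_cases a <;> fin_cases c <;>
    simp [rightLeg, Matrix.mul_apply, Fintype.sum_prod_type]

theorem leftLeg_mul_rightLeg_comm {T S : Matrix (Fin 2) (Fin 2) 𝒜}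
    (h : ∀ a b c d, Commute (T a b) (S c d)) :
    leftLeg T * rightLeg S = rightLeg S * leftLeg T := by
  ext ⟨a, b⟩ ⟨c, d⟩
  simp [leftLeg, rightLeg, Matrix.mul_apply, Fintype.sum_prod_type, (h a c b d).eq]

theorem commute_prod_entry {κ : Type*} (T : κ → Matrix (Fin 2) (Fin 2) 𝒜) (x : 𝒜) (l : List κ)
    (h : ∀ k ∈ l, ∀ a b, Commute x (T k a b)) (a b : Fin 2) : Commute x ((l.map T).prod a b) := by
  induction l generalizing a b with
  | nil =>
    rw [List.map_nil, List.prod_nil, Matrix.one_apply]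
    split_ifs
    exacts [Commute.one_right _, Commute.zero_right _]
  | cons k l ih =>
    rw [List.map_cons, List.prod_cons, Matrix.mul_apply]
    exact Commute.sum_right _ _ _ fun c _ => Commute.mul_right (h k (by simp) _ _)
      (ih (fun k' hk' => h k' (by simp [hk'])) _ _)

variable [Algebra ℂ 𝒜]

/-- The entries of the (twisted) six-vertex `R`-matrix with spectral parameters `u` and `v`. -/
def rEntry (ω u v : ℂ) (a b : Fin 2 × Fin 2) : ℂ :=
  if a = b then
    if a.1 = a.2 then v - ω * u else if a.1 = 0 then ω * (v - u) else v - u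
  else if a = b.swap then if a.1 = 0 then (1 - ω) * u else (1 - ω) * v
  else 0

/-- The (twisted) six-vertex `R`-matrix with entries in `𝒜`. -/
def rMatrix (𝒜 : Type*) [Ring 𝒜] [Algebra ℂ 𝒜] (ω u v : ℂ) :
    Matrix (Fin 2 × Fin 2) (Fin 2 × Fin 2) 𝒜 :=
  Matrix.of fun a b => algebraMap ℂ 𝒜 (rEntry ω u v a b)

/-- The exchange relation `R(u, v) T₁ T'₂ = T'₂ T₁ R(u, v)`. -/
def IsRTT (ω u v : ℂ) (T T' : Matrix (Fin 2) (Fin 2) 𝒜) : Prop :=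
  rMatrix 𝒜 ω u v * (leftLeg T * rightLeg T') = rightLeg T' * leftLeg T * rMatrix 𝒜 ω u v

theorem IsRTT.one (ω u v : ℂ) : IsRTT ω u v (1 : Matrix (Fin 2) (Fin 2) 𝒜) 1 := by
  simp [IsRTT, leftLeg_one, rightLeg_one]

/-- Exchange relations are inherited by products of monodromy matrices with commuting entries. -/
theorem IsRTT.mul {ω u v : ℂ} {T T' S S' : Matrix (Fin 2) (Fin 2) 𝒜} (hT : IsRTT ω u v T T')
    (hS : IsRTT ω u v S S') (h₁ : ∀ a b c d, Commute (S a b) (T' c d))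
    (h₂ : ∀ a b c d, Commute (T a b) (S' c d)) : IsRTT ω u v (T * S) (T' * S') := by
  unfold IsRTT at *
  rw [leftLeg_mul, rightLeg_mul]
  have c₁ := leftLeg_mul_rightLeg_comm h₁
  have c₂ := leftLeg_mul_rightLeg_comm h₂
  calc _ = rMatrix 𝒜 ω u v * (leftLeg T * (leftLeg S * rightLeg T') * rightLeg S') := by
        simp only [mul_assoc]
    _ = rMatrix 𝒜 ω u v * (leftLeg T * rightLeg T') * leftLeg S * rightLeg S' := by
        rw [c₁]; simp only [mul_assoc]
    _ = rightLeg T' * leftLeg T * (rMatrix 𝒜 ω u v * (leftLeg S * rightLeg S')) := by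
        rw [hT]; simp only [mul_assoc]
    _ = rightLeg T' * (leftLeg T * rightLeg S') * leftLeg S * rMatrix 𝒜 ω u v := by
        rw [hS]; simp only [mul_assoc]
    _ = _ := by rw [c₂]; simp only [mul_assoc]

theorem IsRTT.map {ω u v : ℂ} {ℬ : Type*} [Ring ℬ] [Algebra ℂ ℬ]
    {T T' : Matrix (Fin 2) (Fin 2) 𝒜} (hT : IsRTT ω u v T T') (f : 𝒜 →ₐ[ℂ] ℬ) :
    IsRTT ω u v (T.map f) (T'.map f) := by
  have hl : ∀ T : Matrix (Fin 2) (Fin 2) 𝒜, leftLeg (T.map f) = (leftLeg T).map f := fun T => by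
    ext a b; simp [leftLeg, apply_ite f]
  have hr : ∀ T : Matrix (Fin 2) (Fin 2) 𝒜, rightLeg (T.map f) = (rightLeg T).map f := fun T => by
    ext a b; simp [rightLeg, apply_ite f]
  have hR : rMatrix ℬ ω u v = (rMatrix 𝒜 ω u v).map f := by
    ext a b; simp [rMatrix]
  unfold IsRTT at *
  rw [hl, hr, hR, ← Matrix.map_mul, ← Matrix.map_mul, hT, Matrix.map_mul, Matrix.map_mul]

/-- The exchange relation of a monodromy matrix follows from that of its local `L`-operators, if the
entries of different ones commute. -/
theorem IsRTT.list_prod {κ : Type*} {ω u v : ℂ} {T T' : κ → Matrix (Fin 2) (Fin 2) 𝒜}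
    (hT : ∀ k, IsRTT ω u v (T k) (T' k))
    (hc : ∀ k k', k ≠ k' → ∀ a b c d, Commute (T k a b) (T' k' c d)) (l : List κ) (hl : l.Nodup) :
    IsRTT ω u v (l.map T).prod (l.map T').prod := by
  induction l with
  | nil => exact IsRTT.one _ _ _
  | cons k l ih =>
    rw [List.nodup_cons] at hl
    rw [List.map_cons, List.prod_cons, List.map_cons, List.prod_cons]
    refine (hT k).mul (ih hl.2) ?_ ?_
    · intro a b c d
      refine (commute_prod_entry T _ l (fun k' hk' a b => ?_) a b).symm
      exact (hc k' k (fun h => hl.1 (h ▸ hk')) _ _ _ _).symm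
    · intro a b c d
      exact commute_prod_entry T' _ l (fun k' hk' c d =>
        hc k k' (fun h => hl.1 (h ▸ hk')) _ _ _ _) c d

/-- The exchange of `A(u)` and `B(v)`, from one entry of the relation at the parameters `(v, u)`. -/
theorem IsRTT.A_mul_B {ω u v : ℂ} {T T' : Matrix (Fin 2) (Fin 2) 𝒜} (h : IsRTT ω v u T' T)
    (huv : u ≠ v) :
    T 0 0 * T' 0 1 = ((u - ω * v) / (u - v)) • (T' 0 1 * T 0 0) +
      ((ω - 1) * v / (u - v)) • (T 0 1 * T' 0 0) := by
  have h1 := congrFun (congrFun h (0, 0)) (1, 0)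
  simp [Matrix.mul_apply, Fintype.sum_prod_type, rMatrix, leftLeg, rightLeg, rEntry, -map_sub,
    -map_mul, ← Algebra.smul_def, ← Algebra.commutes] at h1
  have h2 := sub_ne_zero.2 huv
  apply smul_right_injective 𝒜 h2
  simp only [smul_add, smul_smul, mul_div_cancel₀ _ h2, h1]
  module

/-- The exchange of `D(u)` and `B(v)`, from one entry of the relation at the parameters `(u, v)`. -/
theorem IsRTT.D_mul_B {ω u v : ℂ} {T T' : Matrix (Fin 2) (Fin 2) 𝒜} (h : IsRTT ω u v T T')
    (huv : u ≠ v) :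
    T 1 1 * T' 0 1 = ((v - ω * u) / (v - u)) • (T' 0 1 * T 1 1) +
      (-((ω - 1) * v / (u - v))) • (T 0 1 * T' 1 1) := by
  have h1 := congrFun (congrFun h (1, 0)) (1, 1)
  simp [Matrix.mul_apply, Fintype.sum_prod_type, rMatrix, leftLeg, rightLeg, rEntry, -map_sub,
    -map_mul, ← Algebra.smul_def, ← Algebra.commutes] at h1
  have h2 := sub_ne_zero.2 huv.symm
  have e : -((ω - 1) * v / (u - v)) = (ω - 1) * v / (v - u) := by
    rw [← div_neg, neg_sub]
  apply smul_right_injective 𝒜 h2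
  simp only [e, smul_add, smul_smul, mul_div_cancel₀ _ h2, ← h1]
  module

/-- The exchange relation yields `B(u) B(v) = B(v) B(u)` only where the `R`-matrix entry `v - ω u`
does not vanish; the remaining value of `v` is reached by continuity. -/
theorem commute_B_of_isRTT [TopologicalSpace 𝒜] [T2Space 𝒜] [ContinuousMul 𝒜] {ω : ℂ}
    {T : ℂ → Matrix (Fin 2) (Fin 2) 𝒜} (hT : ∀ u v, IsRTT ω u v (T u) (T v))
    (hc : Continuous fun z => T z 0 1) (u v : ℂ) : Commute (T u 0 1) (T v 0 1) := by
  have h : Set.EqOn (fun v => T u 0 1 * T v 0 1) (fun v => T v 0 1 * T u 0 1) {ω * u}ᶜ := by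
    intro v hv
    have h1 := congrFun (congrFun (hT u v) (0, 0)) (1, 1)
    simp [Matrix.mul_apply, Fintype.sum_prod_type, rMatrix, leftLeg, rightLeg, rEntry, -map_sub,
      -map_mul, ← Algebra.smul_def, ← Algebra.commutes] at h1
    exact smul_right_injective 𝒜 (sub_ne_zero.2 hv) h1
  exact congrFun (Continuous.ext_on (dense_compl_singleton (ω * u)) (continuous_const.mul hc)
    (hc.mul continuous_const) h) v

end RTT

/-! ### The exchange relation of the cyclic `L`-operator -/

section LocalRTT

variable {N : ℕ} {ω : ℂ}

/-- The weighted shift `v_σ ↦ h (σ + m) v_{σ + m}`. -/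
def wShift (h : ZMod N → ℂ) (m : ZMod N) : Matrix (ZMod N) (ZMod N) ℂ :=
  Matrix.of fun a b => if a = b + m then h a else 0

theorem wShift_add (h h' : ZMod N → ℂ) (m : ZMod N) :
    wShift h m + wShift h' m = wShift (fun σ => h σ + h' σ) m := by
  ext a b
  simp only [wShift, Matrix.add_apply, Matrix.of_apply]
  split_ifs <;> simp

theorem smul_wShift (r : ℂ) (h : ZMod N → ℂ) (m : ZMod N) :
    r • wShift h m = wShift (fun σ => r * h σ) m := by
  ext a b
  simp only [wShift, Matrix.smul_apply, Matrix.of_apply]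
  split_ifs <;> simp

variable [NeZero N]

theorem wShift_mul (h h' : ZMod N → ℂ) (m m' : ZMod N) :
    wShift h m * wShift h' m' = wShift (fun σ => h σ * h' (σ - m)) (m' + m) := by
  ext a b
  simp only [wShift, Matrix.mul_apply, Matrix.of_apply]
  rw [Finset.sum_eq_single (a - m)]
  · simp [sub_eq_iff_eq_add, add_assoc]
  · intro x _ hx
    rw [if_neg (fun e => hx (by rw [e, add_sub_cancel_right])), zero_mul]
  · simp

/-- All entries of the cyclic `L`-operator are weighted shifts, so that identities between their
products reduce to identities between weights. -/
theorem cyclicL_eq_wShift (h : ω ^ N = 1) (p p' : Rapidity) (z : ℂ) :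
    cyclicL (N := N) ω p p' z =
      !![wShift (fun σ => -(p.y * p'.y * z) + p.μ * p'.μ * chr ω σ) 0,
        wShift (fun σ => -z * (p.y - p'.x * p.μ * p'.μ * chr ω σ)) 1;
        wShift (fun σ => p'.y - p.x * p.μ * p'.μ * ω * chr ω σ) (-1),
        wShift (fun σ => 1 - p.x * p'.x * p.μ * p'.μ * z * ω * chr ω σ) 0] := by
  have hZ : ∀ σ : ZMod N, (ω ^ σ.val) ^ (1 : ZMod N).val = chr ω σ := fun σ => by
    change chr ω σ ^ _ = _
    rw [← chr_mul h, mul_one]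
  ext i j a b
  fin_cases i <;> fin_cases j
  · simp [cyclicL, Zop, wShift, hZ, Matrix.one_apply, Matrix.diagonal_apply]
    split_ifs <;> simp
  · simp [cyclicL, Zop, Xop, wShift, hZ, Matrix.sub_mul]
    split_ifs <;> simp
  · simp [cyclicL, Zop, Xop, wShift, hZ, Matrix.mul_sub]
    split_ifs with hab
    · rw [show b = a + 1 by rw [hab]; ring, chr_add h, chr_one h]
      ring
    · simp
  · simp [cyclicL, Zop, wShift, hZ, Matrix.one_apply, Matrix.diagonal_apply]
    split_ifs <;> simp

/-- The exchange relation of the cyclic `L`-operator. Each of its entries compares two weighted shifts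
with the same displacement. -/
theorem isRTT_cyclicL (h : ω ^ N = 1) (p p' : Rapidity) (u v : ℂ) :
    IsRTT ω u v (cyclicL (N := N) ω p p' u) (cyclicL ω p p' v) := by
  have hω0 : ω ≠ 0 := by
    rintro rfl
    simp [zero_pow (NeZero.ne N)] at h
  have e₁ : ∀ σ : ZMod N, chr ω (σ - 1) = ω⁻¹ * chr ω σ := fun σ => by
    rw [← chr_sub_one h σ, inv_mul_cancel_left₀ hω0]
  have e₂ : ∀ σ : ZMod N, chr ω (σ + 1) = ω * chr ω σ := fun σ => by
    rw [chr_add h, chr_one h, mul_comm]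
  rw [cyclicL_eq_wShift h, cyclicL_eq_wShift h, IsRTT]
  ext1 ⟨a, b⟩ ⟨c, d⟩
  fin_cases a <;> fin_cases b <;> fin_cases c <;> fin_cases d <;>
    simp [Matrix.mul_apply, Fintype.sum_prod_type, rMatrix, leftLeg, rightLeg, rEntry, -map_sub,
      -map_mul, ← Algebra.smul_def, ← Algebra.commutes, wShift_mul, wShift_add, smul_wShift,
      e₁, e₂, -mul_eq_mul_left_iff, -mul_eq_mul_right_iff] <;>
    (refine congrArg₂ wShift (funext fun σ => ?_) rfl; field_simp) <;> ring

end LocalRTT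

/-! ### Operators on one site of the chain -/

section Sites

variable {N L : ℕ} [NeZero N]

theorem siteOp_mul_apply (i : Fin L) (M : Matrix (ZMod N) (ZMod N) ℂ) (M' : ChainOp N L)
    (σ σ' : Config N L) :
    (siteOp i M * M') σ σ' = ∑ x, M (σ i) x * M' (Function.update σ i x) σ' := by
  rw [Matrix.mul_apply]
  simp only [siteOp, Matrix.of_apply, ite_mul, zero_mul]
  rw [← Finset.sum_filter]
  refine Finset.sum_bij' (fun ρ _ => ρ i) (fun x _ => Function.update σ i x) ?_ ?_ ?_ ?_ ?_
  · simp
  · intro x _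
    simp +contextual [Function.update_of_ne]
  · intro ρ hρ
    rw [Finset.mem_filter] at hρ
    ext j
    by_cases hj : j = i
    · subst hj; simp
    · rw [Function.update_of_ne hj, hρ.2 j hj]
  · simp
  · intro ρ hρ
    rw [Finset.mem_filter] at hρ
    congr 2
    ext j
    by_cases hj : j = i
    · subst hj; simp
    · rw [Function.update_of_ne hj, hρ.2 j hj]

/-- `siteOp i` as a homomorphism of algebras. -/
def siteHom (N : ℕ) [NeZero N] {L : ℕ} (i : Fin L) :
    Matrix (ZMod N) (ZMod N) ℂ →ₐ[ℂ] ChainOp N L :=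
  AlgHom.ofLinearMap
    { toFun := siteOp i
      map_add' := fun M M' => by
        ext σ σ'
        simp only [siteOp, Matrix.of_apply, Matrix.add_apply]
        split_ifs <;> simp
      map_smul' := fun r M => by
        ext σ σ'
        simp only [siteOp, Matrix.of_apply, Matrix.smul_apply, RingHom.id_apply]
        split_ifs <;> simp }
    (by
      ext σ σ'
      simp only [LinearMap.coe_mk, AddHom.coe_mk, siteOp, Matrix.of_apply, Matrix.one_apply]
      by_cases h : σ = σ'
      · simp [h]
      · rw [if_neg h]
        by_cases h' : ∀ j, j ≠ i → σ j = σ' j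
        · rw [if_pos h', if_neg]
          intro hi
          apply h
          ext j
          by_cases hj : j = i
          · rw [hj, hi]
          · rw [h' j hj]
        · rw [if_neg h'])
    (fun M M' => by
      ext σ σ'
      simp only [LinearMap.coe_mk, AddHom.coe_mk, siteOp_mul_apply]
      simp only [siteOp, Matrix.of_apply, Function.update_self, Matrix.mul_apply]
      by_cases h : ∀ j, j ≠ i → σ j = σ' j
      · rw [if_pos h]
        refine Finset.sum_congr rfl fun x _ => ?_
        rw [if_pos fun j hj => by rw [Function.update_of_ne hj, h j hj]]
      · rw [if_neg h]
        refine (Finset.sum_eq_zero fun x _ => ?_).symm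
        rw [if_neg fun h' => h fun j hj => by rw [← h' j hj, Function.update_of_ne hj], mul_zero])

theorem siteOp_mul_siteOp_apply {i j : Fin L} (hij : i ≠ j) (M M' : Matrix (ZMod N) (ZMod N) ℂ)
    (σ σ' : Config N L) :
    (siteOp i M * siteOp j M') σ σ' =
      if ∀ l, l ≠ i → l ≠ j → σ l = σ' l then M (σ i) (σ' i) * M' (σ j) (σ' j) else 0 := by
  rw [siteOp_mul_apply, Finset.sum_eq_single (σ' i)]
  · simp only [siteOp, Matrix.of_apply, Function.update_of_ne hij.symm, mul_ite, mul_zero]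
    congr 1
    refine propext ⟨fun h l hi hj => ?_, fun h l hj => ?_⟩
    · rw [← h l hj, Function.update_of_ne hi]
    · by_cases hl : l = i
      · rw [hl, Function.update_self]
      · rw [Function.update_of_ne hl, h l hl hj]
  · intro x _ hx
    simp only [siteOp, Matrix.of_apply]
    rw [if_neg fun h => hx (by rw [← h i hij, Function.update_self]), mul_zero]
  · simp

theorem commute_siteOp {i j : Fin L} (hij : i ≠ j) (M M' : Matrix (ZMod N) (ZMod N) ℂ) :
    Commute (siteOp i M) (siteOp j M') := by
  ext σ σ'
  rw [siteOp_mul_siteOp_apply hij, siteOp_mul_siteOp_apply hij.symm, mul_comm]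
  congr 1
  exact propext ⟨fun h l h₁ h₂ => h l h₂ h₁, fun h l h₁ h₂ => h l h₂ h₁⟩

/-- The projector onto the reference state. -/
def vacProj (N L : ℕ) [NeZero N] : ChainOp N L := Matrix.single 0 0 1

theorem vacProj_mulVec : vacProj N L *ᵥ vac N L = vac N L := by
  rw [vacProj, Matrix.single_mulVec]
  simp only [vac, Pi.single_eq_same, mul_one]
  rfl

/-- A local operator with eigenvector `v₀` has the reference state as eigenvector. -/
theorem siteOp_mul_vacProj (i : Fin L) {M : Matrix (ZMod N) (ZMod N) ℂ} {r : ℂ}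
    (hM : ∀ x, M x 0 = if x = 0 then r else 0) : siteOp i M * vacProj N L = r • vacProj N L := by
  ext σ σ'
  rw [siteOp_mul_apply]
  simp only [vacProj, Matrix.smul_apply, Matrix.single_apply, mul_ite, mul_one, mul_zero,
    smul_eq_mul]
  by_cases h' : (0 : Config N L) = σ'
  · simp only [h', and_true]
    subst h'
    have e : ∀ x, ((0 : Config N L) = Function.update σ i x) ↔ x = 0 ∧ ∀ j, j ≠ i → σ j = 0 := by
      intro x
      constructor
      · intro h
        refine ⟨by simpa using (congrFun h i).symm, fun j hj => ?_⟩
        simpa [Function.update_of_ne hj] using (congrFun h j).symm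
      · rintro ⟨rfl, h⟩
        ext j
        by_cases hj : j = i
        · subst hj; simp
        · simp [Function.update_of_ne hj, h j hj]
    simp only [e]
    rw [Finset.sum_eq_single 0 (fun x _ hx => by simp [hx]) (by simp), hM]
    by_cases h0 : σ = 0
    · simp [h0]
    · rw [if_neg (Ne.symm h0)]
      by_cases hi : σ i = 0
      · rw [if_neg]
        rintro ⟨-, h⟩
        apply h0
        ext j
        by_cases hj : j = i
        · rw [hj, hi]; rfl
        · rw [h j hj]; rfl
      · simp [hi]
  · simp [h']

end Sites

/-! ### The monodromy matrix of the `τ₂`-model -/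

section Monodromy

variable {N L : ℕ} [NeZero N] {ω : ℂ}

/-- The `L`-operator at site `i` of the chain. -/
def siteL (ω : ℂ) (p : Fin L → Rapidity) (z : ℂ) (i : Fin L) :
    Matrix (Fin 2) (Fin 2) (ChainOp N L) :=
  (cyclicL ω (p i) (p i).bar z).map (siteHom N i)

theorem tau2T_eq (p : Fin L → Rapidity) (z : ℂ) :
    tau2T (N := N) ω p z = ((List.finRange L).map (siteL ω p z)).prod := by
  rw [tau2T, List.ofFn_eq_map]
  rfl

theorem commute_siteL (p : Fin L → Rapidity) (u v : ℂ) {i j : Fin L} (hij : i ≠ j)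
    (a b c d : Fin 2) : Commute (siteL (N := N) ω p u i a b) (siteL ω p v j c d) :=
  commute_siteOp hij _ _

theorem isRTT_tau2T (h : ω ^ N = 1) (p : Fin L → Rapidity) (u v : ℂ) :
    IsRTT ω u v (tau2T (N := N) ω p u) (tau2T ω p v) := by
  rw [tau2T_eq, tau2T_eq]
  exact IsRTT.list_prod (fun i => (isRTT_cyclicL h _ _ u v).map _)
    (fun i j hij => commute_siteL p u v hij) _ (List.nodup_finRange L)

theorem continuous_cyclicL (p p' : Rapidity) : Continuous fun z => cyclicL (N := N) ω p p' z := by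
  refine continuous_matrix fun i j => ?_
  fin_cases i <;> fin_cases j <;> simp [cyclicL] <;> fun_prop

theorem continuous_siteHom (i : Fin L) : Continuous (siteHom N i) :=
  LinearMap.continuous_of_finiteDimensional (siteHom N i).toLinearMap

theorem continuous_tau2T (p : Fin L → Rapidity) : Continuous fun z => tau2T (N := N) ω p z := by
  simp only [tau2T_eq]
  refine continuous_list_prod _ fun i _ => ?_
  exact (continuous_cyclicL _ _).matrix_map (continuous_siteHom i)

/-- The first column of the local `L`-operators with `p' = p̄` is triangular on `v₀`. -/
theorem siteL_mul_vacProj (h : ω ^ N = 1) (p : Fin L → Rapidity) (hp : ∀ i, (p i).μ ≠ 0) (z : ℂ)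
    (i : Fin L) :
    siteL (N := N) ω p z i 0 0 * vacProj N L = (1 - (p i).t * z) • vacProj N L ∧
    siteL (N := N) ω p z i 1 0 * vacProj N L = 0 ∧
    siteL (N := N) ω p z i 1 1 * vacProj N L = (1 - (p i).t * z * ω) • vacProj N L := by
  have hμ : (p i).μ * (p i).bar.μ = 1 := mul_inv_cancel₀ (hp i)
  have hx : (p i).bar.x = (p i).y := rfl
  have hy : (p i).bar.y = (p i).x := rfl
  have hC : siteL (N := N) ω p z i 1 0 * vacProj N L = (0 : ℂ) • vacProj N L := by
    refine siteOp_mul_vacProj i fun x => ?_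
    rw [cyclicL_eq_wShift h]
    simp only [wShift, mul_assoc, hμ, hy, Matrix.of_apply, Matrix.cons_val', Matrix.cons_val_zero,
      Matrix.cons_val_one, zero_add, ite_self, Matrix.cons_val_fin_one]
    split_ifs with hx
    · have h1 := chr_neg_mul h (1 : ZMod N)
      rw [chr_one h] at h1
      rw [hx]
      linear_combination (-(p i).x) * h1
    · rfl
  refine ⟨siteOp_mul_vacProj i fun x => ?_, by rw [hC, zero_smul], siteOp_mul_vacProj i fun x => ?_⟩
  · rw [cyclicL_eq_wShift h]
    simp only [wShift, hμ, hy, Matrix.of_apply, Matrix.cons_val', Matrix.cons_val_zero, add_zero]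
    refine if_ctx_congr Iff.rfl (fun hx => ?_) fun _ => rfl
    rw [hx, chr_zero, Rapidity.t]
    ring
  · rw [cyclicL_eq_wShift h]
    simp only [wShift, mul_assoc _ _ (p i).bar.μ, hμ, hx, Matrix.of_apply,
      Matrix.cons_val', Matrix.cons_val_one, Matrix.cons_val_fin_one, add_zero]
    refine if_ctx_congr Iff.rfl (fun hx => ?_) fun _ => rfl
    rw [hx, chr_zero, Rapidity.t]
    ring

/-- The reference state is an eigenvector of `A(z)` and `D(z)` and is annihilated by `C(z)`. -/
theorem tau2T_mul_vacProj (h : ω ^ N = 1) (p : Fin L → Rapidity) (hp : ∀ i, (p i).μ ≠ 0) (z : ℂ) :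
    tau2T (N := N) ω p z 0 0 * vacProj N L = a p z • vacProj N L ∧
    tau2T (N := N) ω p z 1 0 * vacProj N L = 0 ∧
    tau2T (N := N) ω p z 1 1 * vacProj N L = d ω p z • vacProj N L := by
  have key : ∀ l : List (Fin L), l.Nodup →
      (l.map (siteL (N := N) ω p z)).prod 0 0 * vacProj N L =
        (l.map fun i => 1 - (p i).t * z).prod • vacProj N L ∧
      (l.map (siteL (N := N) ω p z)).prod 1 0 * vacProj N L = 0 ∧
      (l.map (siteL (N := N) ω p z)).prod 1 1 * vacProj N L =
        (l.map fun i => 1 - (p i).t * z * ω).prod • vacProj N L := by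
    intro l hl
    induction l with
    | nil => simp
    | cons i l ih =>
      rw [List.nodup_cons] at hl
      obtain ⟨hA, hC, hD⟩ := ih hl.2
      obtain ⟨kA, kC, kD⟩ := siteL_mul_vacProj h p hp z i
      -- `B` of the remaining sites does not preserve the reference state, but it commutes with the
      -- operator `C` of site `i`, which annihilates that state.
      have hcomm : Commute (siteL (N := N) ω p z i 1 0) ((l.map (siteL ω p z)).prod 0 1) :=
        commute_prod_entry _ _ l (fun j hj _ _ =>
          commute_siteL p z z (fun e : i = j => hl.1 (e ▸ hj)) _ _ _ _) 0 1
      simp only [List.map_cons, List.prod_cons, Matrix.mul_apply, Fin.sum_univ_two, add_mul]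
      refine ⟨?_, ?_, ?_⟩
      · rw [mul_assoc, mul_assoc, hA, hC, mul_zero, add_zero, mul_smul_comm, kA, smul_smul,
          mul_comm]
      · rw [mul_assoc, mul_assoc, hA, hC, mul_zero, add_zero, mul_smul_comm, kC, smul_zero]
      · rw [hcomm.eq, mul_assoc, mul_assoc, hD, kC, mul_zero, zero_add, mul_smul_comm, kD,
          smul_smul, mul_comm]
  rw [tau2T_eq, a, d, Fin.prod_univ_def, Fin.prod_univ_def]
  exact key _ (List.nodup_finRange L)

end Monodromy

/-! ### The intertwining property of the superintegrable monodromy matrix -/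

section Intertwining

variable {N L : ℕ} {ω : ℂ}

theorem onCurve_bar {k k' : ℂ} {p : Rapidity} (hp : p.OnCurve N k k') : p.bar.OnCurve N k k' := by
  obtain ⟨h0, hx, hy⟩ := hp
  refine ⟨inv_ne_zero h0, ?_, hx⟩
  simpa [Rapidity.bar] using hy

theorem onCurve_barShift (h : ω ^ N = 1) {k k' : ℂ} {q : Rapidity} (hq : q.OnCurve N k k')
    (s : ZMod N) : (q.barShift ω s).OnCurve N k k' := by
  obtain ⟨h0, hx, hy⟩ := hq
  refine ⟨inv_ne_zero h0, ?_, ?_⟩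
  · simpa [Rapidity.barShift] using hy
  · simp only [Rapidity.barShift]
    rw [mul_pow, ← pow_mul, mul_comm s.val, pow_mul, h, one_pow, mul_one, hx]

variable [NeZero N]

/-- Operators on quantum space `⊗` auxiliary space, as matrices over the auxiliary space. -/
abbrev BigOp (N L : ℕ) := Matrix (ZMod N) (ZMod N) (ChainOp N L)

/-- Operators on the quantum space, acting trivially on the auxiliary space. -/
def quantumHom (N L : ℕ) [NeZero N] : ChainOp N L →ₐ[ℂ] BigOp N L :=
  Matrix.scalarAlgHom (ZMod N) ℂ

/-- Operators on the auxiliary space, acting trivially on the quantum space. -/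
def auxHom (N L : ℕ) [NeZero N] : Matrix (ZMod N) (ZMod N) ℂ →ₐ[ℂ] BigOp N L :=
  (Algebra.ofId ℂ (ChainOp N L)).mapMatrix

/-- Operators on two local spaces, placed on site `i` and the auxiliary space. -/
def pairHom (N : ℕ) [NeZero N] {L : ℕ} (i : Fin L) :
    Matrix (ZMod N × ZMod N) (ZMod N × ZMod N) ℂ →ₐ[ℂ] BigOp N L :=
  AlgHom.ofLinearMap
    { toFun := fun M => Matrix.of fun τ' τ => siteHom N i (Matrix.of fun a b => M (a, τ') (b, τ))
      map_add' := fun M M' => by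
        ext1 τ' τ
        simp only [Matrix.of_apply, Matrix.add_apply, ← map_add]
        rfl
      map_smul' := fun r M => by
        ext1 τ' τ
        simp only [Matrix.of_apply, Matrix.smul_apply, RingHom.id_apply, ← map_smul]
        rfl }
    (by
      ext1 τ' τ
      simp only [LinearMap.coe_mk, AddHom.coe_mk, Matrix.of_apply, Matrix.one_apply (i := τ')]
      split_ifs with h
      · rw [← map_one (siteHom N i)]
        congr 1
        ext a b
        simp [Matrix.one_apply, h]
      · rw [← map_zero (siteHom N i)]
        congr 1
        ext a b
        simp [h])
    (fun M M' => by
      ext1 τ' τ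
      simp only [LinearMap.coe_mk, AddHom.coe_mk, Matrix.of_apply, Matrix.mul_apply (i := τ'),
        ← map_mul, ← map_sum]
      congr 1
      ext a b
      simp only [Matrix.of_apply, Matrix.sum_apply, Matrix.mul_apply, Fintype.sum_prod_type]
      exact Finset.sum_comm)

theorem pairHom_kronLeft (i : Fin L) (M : Matrix (ZMod N) (ZMod N) ℂ) :
    pairHom N i (kronLeft N M) = quantumHom N L (siteHom N i M) := by
  ext1 τ' τ
  change siteHom N i (Matrix.of fun a b => (M ⊗ₖ (1 : Matrix (ZMod N) (ZMod N) ℂ)) (a, τ') (b, τ)) =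
    Matrix.diagonal (fun _ => siteHom N i M) τ' τ
  rw [Matrix.diagonal_apply]
  split_ifs with h
  · congr 1
    ext a b
    simp [h]
  · rw [← map_zero (siteHom N i)]
    congr 1
    ext a b
    simp [h]

theorem pairHom_kronRight (i : Fin L) (M : Matrix (ZMod N) (ZMod N) ℂ) :
    pairHom N i (kronRight N M) = auxHom N L M := by
  ext1 τ' τ
  change siteHom N i (Matrix.of fun a b => ((1 : Matrix (ZMod N) (ZMod N) ℂ) ⊗ₖ M) (a, τ') (b, τ)) =
    algebraMap ℂ _ (M τ' τ)
  rw [← AlgHom.commutes (siteHom N i)]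
  congr 1
  ext a b
  simp [Matrix.algebraMap_matrix_apply, Matrix.one_apply]

theorem commute_quantumHom_auxHom (A : ChainOp N L) (M : Matrix (ZMod N) (ZMod N) ℂ) :
    Commute (quantumHom N L A) (auxHom N L M) := by
  rw [commute_iff_eq]
  ext1 τ' τ
  simp only [quantumHom, auxHom, Matrix.scalarAlgHom_apply, Matrix.scalar_apply,
    Matrix.diagonal_mul, Matrix.mul_diagonal, AlgHom.mapMatrix_apply, Matrix.map_apply]
  exact (Algebra.commutes _ _).symm

theorem commute_Ssite (p p' q q' : Rapidity) {i j : Fin L} (hij : i ≠ j)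
    (M : Matrix (ZMod N) (ZMod N) ℂ) :
    Commute (Ssite ω p p' q q' i) (quantumHom N L (siteHom N j M)) := by
  rw [commute_iff_eq]
  ext1 τ' τ
  simp only [quantumHom, Matrix.scalarAlgHom_apply, Matrix.scalar_apply,
    Matrix.diagonal_mul, Matrix.mul_diagonal, Ssite, Matrix.of_apply]
  exact commute_siteOp hij _ _

/-- The monodromy matrix of the `τ₂`-model as a matrix of operators on quantum space `⊗` auxiliary
space. -/
def bigT (ω : ℂ) (p : Fin L → Rapidity) (z : ℂ) : Matrix (Fin 2) (Fin 2) (BigOp N L) :=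
  (tau2T ω p z).map (quantumHom N L)

/-- The `L`-operator with parameters `q₁ = q`, `q₂ = q̄(s)` on the auxiliary space. -/
def auxL (L : ℕ) (ω : ℂ) (q : Rapidity) (s : ZMod N) (z : ℂ) :
    Matrix (Fin 2) (Fin 2) (BigOp N L) :=
  (cyclicL ω q (q.barShift ω s) z).map (auxHom N L)

/-- The superintegrable monodromy matrix exchanges the two orders of multiplication of the
monodromy matrix of the `τ₂`-model and the auxiliary `L`-operator. -/
theorem scpT_mul_bigT_mul_auxL (hω : IsPrimitiveRoot ω N) {k k' : ℂ} (hk : k ≠ 0)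
    {p : Fin L → Rapidity} {q : Rapidity} (hp : ∀ i, (p i).OnCurve N k k')
    (hq : q.OnCurve N k k') (hpx : ∀ i, ∀ m : ℕ, (p i).x ≠ q.x * ω ^ m)
    (hpy : ∀ i, ∀ m : ℕ, (p i).y ≠ q.y * ω ^ m) (s : ZMod N) (z : ℂ) :
    Matrix.scalar (Fin 2) (scpT ω p q (q.barShift ω s)) * (bigT ω p z * auxL L ω q s z) =
      auxL L ω q s z * bigT ω p z * Matrix.scalar (Fin 2) (scpT ω p q (q.barShift ω s)) := by
  have h := hω.pow_eq_one
  -- The non-degeneracy conditions are needed with the roots of unity on either side, and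
  -- `ω ^ (m (N - 1))` is the inverse of `ω ^ m`.
  have hinv : ∀ m : ℕ, ω ^ m * ω ^ (m * (N - 1)) = 1 := fun m => by
    have hN : 1 ≤ N := Nat.one_le_iff_ne_zero.2 (NeZero.ne N)
    rw [← pow_add, show m + m * (N - 1) = N * m by
      obtain ⟨r, rfl⟩ := Nat.exists_eq_add_of_le hN
      rw [Nat.add_sub_cancel_left]; ring, pow_mul, h, one_pow]
  -- The Yang–Baxter relation of `S`, transported to site `i` and the auxiliary space.
  have loc : ∀ i, Matrix.scalar (Fin 2) (Ssite ω (p i) (p i).bar q (q.barShift ω s) i) *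
      ((siteL ω p z i).map (quantumHom N L) * auxL L ω q s z) =
      auxL L ω q s z * (siteL ω p z i).map (quantumHom N L) *
        Matrix.scalar (Fin 2) (Ssite ω (p i) (p i).bar q (q.barShift ω s) i) := by
    intro i
    have key := S_mul_cyclicL hω hk (hp i) (onCurve_bar (hp i)) hq (onCurve_barShift h hq s)
      (hpy i) (fun m hm => hpy i (m * (N - 1)) (by rw [hm, mul_assoc, hinv, mul_one]))
      (fun m hm => hpx i (s.val + m * (N - 1)) (by
        change q.x * ω ^ s.val = (p i).x * ω ^ m at hm
        rw [pow_add, ← mul_assoc, hm, mul_assoc, hinv, mul_one])) (hpx i) z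
    have key' := congrArg (fun M => M.map (pairHom N i)) key
    simp only [Matrix.map_mul, Matrix.map_map] at key'
    have e₁ : (pairHom N i) ∘ (kronLeft N) = fun M => quantumHom N L (siteHom N i M) :=
      funext (pairHom_kronLeft i)
    have e₂ : (pairHom N i) ∘ (kronRight N) = auxHom N L := funext (pairHom_kronRight i)
    have e₃ : (Matrix.scalar (Fin 2) (S ω (p i) (p i).bar q (q.barShift ω s))).map (pairHom N i) =
        Matrix.scalar (Fin 2) (Ssite ω (p i) (p i).bar q (q.barShift ω s) i) := by
      rw [Matrix.scalar_apply, Matrix.diagonal_map (map_zero _)]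
      rfl
    rw [e₁, e₂, e₃] at key'
    exact key'
  have key : ∀ l : List (Fin L), l.Nodup →
      Matrix.scalar (Fin 2) (l.map fun i => Ssite ω (p i) (p i).bar q (q.barShift ω s) i).prod *
      ((l.map fun i => (siteL ω p z i).map (quantumHom N L)).prod * auxL L ω q s z) =
      auxL L ω q s z * (l.map fun i => (siteL ω p z i).map (quantumHom N L)).prod *
      Matrix.scalar (Fin 2) (l.map fun i => Ssite ω (p i) (p i).bar q (q.barShift ω s) i).prod := by
    intro l hl
    induction l with
    | nil => simp
    | cons i l ih =>
      rw [List.nodup_cons] at hl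
      have ih' := ih hl.2
      simp only [List.map_cons, List.prod_cons, map_mul]
      have c₁ : Matrix.scalar (Fin 2)
          (l.map fun i => Ssite ω (p i) (p i).bar q (q.barShift ω s) i).prod *
          (siteL ω p z i).map (quantumHom N L) = (siteL ω p z i).map (quantumHom N L) *
          Matrix.scalar (Fin 2)
          (l.map fun i => Ssite ω (p i) (p i).bar q (q.barShift ω s) i).prod := by
        refine scalar_mul_comm fun a b => (Commute.list_prod_right _ _ ?_).symm
        intro x hx
        obtain ⟨j, hj, rfl⟩ := List.mem_map.1 hx
        exact (commute_Ssite _ _ _ _ (fun e : j = i => hl.1 (e ▸ hj)) _).symm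
      have c₂ : Matrix.scalar (Fin 2) (Ssite ω (p i) (p i).bar q (q.barShift ω s) i) *
          (l.map fun i => (siteL ω p z i).map (quantumHom N L)).prod =
          (l.map fun i => (siteL ω p z i).map (quantumHom N L)).prod *
          Matrix.scalar (Fin 2) (Ssite ω (p i) (p i).bar q (q.barShift ω s) i) := by
        refine scalar_mul_comm fun a b => commute_prod_entry _ _ l (fun j hj a b => ?_) a b
        exact commute_Ssite _ _ _ _ (fun e : i = j => hl.1 (e ▸ hj)) _
      have hi := loc i
      generalize Matrix.scalar (Fin 2) (Ssite (N := N) ω (p i) (p i).bar q (q.barShift ω s) i) = s₁ at *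
      generalize Matrix.scalar (Fin 2)
        (l.map fun i => Ssite (N := N) ω (p i) (p i).bar q (q.barShift ω s) i).prod = s₂ at *
      generalize (l.map fun i => (siteL (N := N) ω p z i).map (quantumHom N L)).prod = t₂ at *
      generalize (siteL (N := N) ω p z i).map (quantumHom N L) = t₁ at *
      calc _ = s₁ * (s₂ * t₁) * t₂ * auxL L ω q s z := by simp only [mul_assoc]
        _ = s₁ * t₁ * (s₂ * (t₂ * auxL L ω q s z)) := by rw [c₁]; simp only [mul_assoc]
        _ = s₁ * (t₁ * auxL L ω q s z) * t₂ * s₂ := by rw [ih']; simp only [mul_assoc]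
        _ = auxL L ω q s z * t₁ * (s₁ * t₂) * s₂ := by rw [hi]; simp only [mul_assoc]
        _ = _ := by rw [c₂]; simp only [mul_assoc]
  have e : bigT (N := N) ω p z =
      ((List.finRange L).map fun i => (siteL (N := N) ω p z i).map (quantumHom N L)).prod := by
    rw [bigT, tau2T_eq]
    change (quantumHom N L).mapMatrix _ = _
    rw [map_list_prod, List.map_map]
    rfl
  rw [e, scpT, List.ofFn_eq_map]
  exact key _ (List.nodup_finRange L)

end Intertwining

/-! ### The exchange functions -/

section Exchange

/-- The coefficient of `B(v) A(u)` in `A(u) B(v)`. -/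
def exchF (ω u v : ℂ) : ℂ := (u - ω * v) / (u - v)

/-- The coefficient of `B(u) A(v)` in `A(u) B(v)`. -/
def exchG (ω u v : ℂ) : ℂ := (ω - 1) * v / (u - v)

/-- The hypothesis `hPQ` of `apply_betheVector` for the diagonal entry `A`. -/
theorem exch_A (ω : ℂ) {u v w : ℂ} (huv : u ≠ v) (huw : u ≠ w) (hvw : v ≠ w) :
    exchF ω u v * exchG ω u w + exchG ω u v * exchG ω v w = exchG ω u w * exchF ω w v := by
  have h₁ := sub_ne_zero.2 huv
  have h₂ := sub_ne_zero.2 huw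
  have h₃ := sub_ne_zero.2 hvw
  have h₄ := sub_ne_zero.2 hvw.symm
  simp only [exchF, exchG]
  field_simp
  ring

/-- The hypothesis `hPQ` of `apply_betheVector` for the diagonal entry `D`. -/
theorem exch_D (ω : ℂ) {u v w : ℂ} (huv : u ≠ v) (huw : u ≠ w) (hvw : v ≠ w) :
    exchF ω v u * -exchG ω u w + -exchG ω u v * -exchG ω v w = -exchG ω u w * exchF ω v w := by
  have h₁ := sub_ne_zero.2 huv
  have h₀ := sub_ne_zero.2 huv.symm
  have h₂ := sub_ne_zero.2 huw
  have h₃ := sub_ne_zero.2 hvw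
  simp only [exchF, exchG]
  field_simp
  ring

theorem omega_mul_f {ω : ℂ} (hω : ω ≠ 0) (u v : ℂ) : ω * f ω u v = exchF ω u v := by
  rw [f, exchF, ← mul_div_assoc, mul_comm (u - v), mul_div_mul_left _ _ hω, mul_comm v]

end Exchange

/-! ### The auxiliary `L`-operator and its inverse row -/

section Boundary

variable {N : ℕ} {ω : ℂ}

theorem single_vecMul_wShift [NeZero N] (h : ZMod N → ℂ) (m σ : ZMod N) :
    Pi.single σ 1 ᵥ* wShift h m = h σ • Pi.single (σ - m) 1 := by
  ext b
  simp only [Matrix.single_one_vecMul, Matrix.row_apply, wShift, Matrix.of_apply, Pi.smul_apply,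
    Pi.single_apply, smul_eq_mul, mul_ite, mul_one, mul_zero, eq_sub_iff_add_eq, eq_comm]

theorem wShift_mulVec_single [NeZero N] (h : ZMod N → ℂ) (m σ : ZMod N) :
    wShift h m *ᵥ Pi.single σ 1 = h (σ + m) • Pi.single (σ + m) 1 := by
  ext b
  simp only [Matrix.mulVec_single_one, Matrix.col_apply, wShift, Matrix.of_apply, Pi.smul_apply,
    Pi.single_apply, smul_eq_mul, mul_ite, mul_one, mul_zero]
  split_ifs with hb
  · rw [hb]
  · rfl

variable [NeZero N]

/-- The auxiliary `L`-operator: `μ` drops out because `μ_q μ_{q̄(s)} = 1`. -/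
theorem cyclicL_barShift (h : ω ^ N = 1) {q : Rapidity} (hq : q.μ ≠ 0) (s : ZMod N) (z : ℂ) :
    cyclicL (N := N) ω q (q.barShift ω s) z =
      !![wShift (fun σ => -(q.t * ω ^ s.val * z) + chr ω σ) 0,
        wShift (fun σ => -(q.y * z) * (1 - chr ω σ)) 1;
        wShift (fun σ => q.x * (ω ^ s.val - ω * chr ω σ)) (-1),
        wShift (fun σ => 1 - q.t * z * ω * chr ω σ) 0] := by
  have hμ : q.μ * (q.barShift ω s).μ = 1 := mul_inv_cancel₀ hq
  have hx : (q.barShift ω s).x = q.y := rfl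
  have hy : (q.barShift ω s).y = q.x * ω ^ s.val := rfl
  rw [cyclicL_eq_wShift h]
  simp only [mul_assoc _ q.μ, hμ, hx, hy, Rapidity.t]
  ext1 i j
  fin_cases i <;> fin_cases j <;> refine congrArg₂ wShift (funext fun σ => ?_) rfl <;> ring

/-- The factor of `μ_{τ'τ}(z)` that does not depend on `τ` and `τ'`; it is what has to be inverted in
order to invert the auxiliary `L`-operator. -/
def muDen (ω : ℂ) (s : ZMod N) (q : Rapidity) (z : ℂ) : ℂ :=
  (q.t * z - 1) * (q.t * z * ω ^ s.val - 1)

/-- Upper left entry of the inverse of the auxiliary `L`-operator (in the sense of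
`row_mul_cyclicL`). -/
def rowA (ω : ℂ) (s : ZMod N) (q : Rapidity) (z : ℂ) : Matrix (ZMod N) (ZMod N) ℂ :=
  wShift (fun σ => (muDen ω s q z)⁻¹ * ((chr ω σ)⁻¹ * (1 - q.t * z * chr ω σ))) 0

/-- Upper right entry of the inverse of the auxiliary `L`-operator (in the sense of
`row_mul_cyclicL`). -/
def rowB (ω : ℂ) (s : ZMod N) (q : Rapidity) (z : ℂ) : Matrix (ZMod N) (ZMod N) ℂ :=
  wShift (fun σ => (muDen ω s q z)⁻¹ * (q.y * z) * ((chr ω σ)⁻¹ * (1 - chr ω σ))) 1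

/-- The row `(rowA, rowB)` is the first row of a left inverse of the auxiliary `L`-operator. -/
theorem row_mul_cyclicL (h : ω ^ N = 1) {q : Rapidity} (hq : q.μ ≠ 0) (s : ZMod N) {z : ℂ}
    (hz : muDen ω s q z ≠ 0) :
    rowA ω s q z * cyclicL ω q (q.barShift ω s) z 0 0 +
      rowB ω s q z * cyclicL ω q (q.barShift ω s) z 1 0 = 1 ∧
    rowA ω s q z * cyclicL ω q (q.barShift ω s) z 0 1 +
      rowB ω s q z * cyclicL ω q (q.barShift ω s) z 1 1 = 0 := by
  have e1 : (1 : Matrix (ZMod N) (ZMod N) ℂ) = wShift (fun _ => 1) 0 := by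
    ext a b; simp [wShift, Matrix.one_apply]
  have e0 : (0 : Matrix (ZMod N) (ZMod N) ℂ) = wShift (fun _ => 0) 1 := by
    ext a b; simp [wShift]
  rw [cyclicL_barShift h hq, e1, e0]
  simp only [rowA, rowB, Matrix.of_apply, Matrix.cons_val', Matrix.cons_val_zero,
    Matrix.cons_val_one, Matrix.cons_val_fin_one, wShift_mul, add_zero, zero_add, sub_zero,
    neg_add_cancel, wShift_add, mul_assoc _ ω, chr_sub_one h]
  refine ⟨congrArg₂ wShift (funext fun σ => ?_) rfl, congrArg₂ wShift (funext fun σ => ?_) rfl⟩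
  · have h1 := chr_ne_zero h σ
    field_simp
    simp only [muDen, Rapidity.t]
    ring
  · have h1 := chr_ne_zero h σ
    field_simp
    ring

/-- `rowA` and `rowB` obey, acting on row vectors from the right, the exchange relation of `A` and
`B`. -/
theorem rowB_mul_rowA (h : ω ^ N = 1) (s : ZMod N) (q : Rapidity) {u v : ℂ} (huv : u ≠ v) :
    rowB ω s q v * rowA ω s q u = exchF ω u v • (rowA ω s q u * rowB ω s q v) +
      exchG ω u v • (rowA ω s q v * rowB ω s q u) := by
  simp only [rowA, rowB, wShift_mul, smul_wShift, add_zero, zero_add, sub_zero, wShift_add]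
  refine congrArg₂ wShift (funext fun σ => ?_) rfl
  have h1 := chr_ne_zero h σ
  have h2 := chr_ne_zero h (σ - 1)
  have h3 := chr_sub_one h σ
  have h4 := sub_ne_zero.2 huv
  have h5 : ω ≠ 0 := fun h0 => h1 (by rw [← h3, h0, zero_mul])
  rw [← h3]
  simp only [exchF, exchG]
  field_simp
  ring

end Boundary

/-! ### Tensor products and contractions over the auxiliary space -/

section Pairings

variable {N L : ℕ} [NeZero N] {ω : ℂ}

/-- The tensor product of an operator on the quantum space and a vector of the auxiliary space. -/
def tensorPair (N L : ℕ) [NeZero N] :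
    ChainOp N L →ₗ[ℂ] (ZMod N → ℂ) →ₗ[ℂ] (ZMod N → ChainOp N L) :=
  LinearMap.mk₂ ℂ (fun v x σ => x σ • v)
    (fun v v' x => by ext1 σ; simp) (fun r v x => by ext1 σ; exact smul_comm _ _ _)
    (fun v x x' => by ext1 σ; simp [add_smul]) (fun r v x => by ext1 σ; simp [mul_smul])

/-- Multiplication by a matrix over the auxiliary space, as a linear map. -/
def bigVec (M : BigOp N L) : (ZMod N → ChainOp N L) →ₗ[ℂ] (ZMod N → ChainOp N L) where
  toFun ψ := M *ᵥ ψ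
  map_add' := Matrix.mulVec_add M
  map_smul' r ψ := Matrix.mulVec_smul M r ψ

/-- The contraction of a row vector, a matrix and a column vector over the auxiliary space. -/
def rowPair (T : BigOp N L) : (ZMod N → ℂ) →ₗ[ℂ] (ZMod N → ChainOp N L) →ₗ[ℂ] ChainOp N L :=
  LinearMap.mk₂ ℂ (fun x ψ => ∑ σ, x σ • (T *ᵥ ψ) σ)
    (fun x x' ψ => by simp [add_smul, Finset.sum_add_distrib])
    (fun r x ψ => by simp [mul_smul, Finset.smul_sum])
    (fun x ψ ψ' => by simp [Matrix.mulVec_add, Finset.sum_add_distrib])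
    (fun r x ψ => by simp [Matrix.mulVec_smul, Finset.smul_sum, smul_comm r])

theorem quantumHom_mulVec_tensorPair (A v : ChainOp N L) (x : ZMod N → ℂ) :
    quantumHom N L A *ᵥ tensorPair N L v x = tensorPair N L (A * v) x := by
  ext1 σ
  simp [quantumHom, tensorPair, Matrix.mulVec, dotProduct, Matrix.diagonal_apply]

theorem auxHom_mulVec_tensorPair (M : Matrix (ZMod N) (ZMod N) ℂ) (v : ChainOp N L)
    (x : ZMod N → ℂ) :
    auxHom N L M *ᵥ tensorPair N L v x = tensorPair N L v (M *ᵥ x) := by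
  ext1 σ
  simp only [auxHom, tensorPair, Matrix.mulVec, dotProduct, LinearMap.mk₂_apply,
    AlgHom.mapMatrix_apply, Matrix.map_apply, Finset.sum_smul, Algebra.ofId_apply, mul_smul,
    ← Algebra.smul_def]

theorem rowPair_auxHom_mul (T : BigOp N L) (M : Matrix (ZMod N) (ZMod N) ℂ) (x : ZMod N → ℂ)
    (ψ : ZMod N → ChainOp N L) :
    rowPair (auxHom N L M * T) x ψ = rowPair T (x ᵥ* M) ψ := by
  simp only [rowPair, LinearMap.mk₂_apply, ← Matrix.mulVec_mulVec]
  generalize T *ᵥ ψ = φ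
  simp only [auxHom, Matrix.mulVec, Matrix.vecMul, dotProduct,
    AlgHom.mapMatrix_apply, Matrix.map_apply, Finset.sum_smul, Algebra.ofId_apply, mul_smul,
    ← Algebra.smul_def, Finset.smul_sum]
  exact Finset.sum_comm

theorem rowPair_quantumHom_mul (T : BigOp N L) (A : ChainOp N L) (x : ZMod N → ℂ)
    (ψ : ZMod N → ChainOp N L) :
    rowPair (quantumHom N L A * T) x ψ = A * rowPair T x ψ := by
  simp only [rowPair, LinearMap.mk₂_apply, ← Matrix.mulVec_mulVec]
  generalize T *ᵥ ψ = φ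
  simp [quantumHom, Matrix.mulVec, dotProduct, Matrix.diagonal_apply, Finset.mul_sum]

theorem rowPair_mul (T M : BigOp N L) (x : ZMod N → ℂ) (ψ : ZMod N → ChainOp N L) :
    rowPair (T * M) x ψ = rowPair T x (M *ᵥ ψ) := by
  simp only [rowPair, LinearMap.mk₂_apply, ← Matrix.mulVec_mulVec]

theorem rowPair_single (T : BigOp N L) (σ τ : ZMod N) (v : ChainOp N L) :
    rowPair T (Pi.single σ 1) (tensorPair N L v (Pi.single τ 1)) = T σ τ * v := by
  simp only [rowPair, tensorPair, LinearMap.mk₂_apply, Matrix.mulVec, dotProduct]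
  rw [Finset.sum_eq_single σ (fun b _ hb => by simp [hb]) (by simp),
    Finset.sum_eq_single τ (fun b _ hb => by simp [hb]) (by simp)]
  simp

end Pairings

/-! ### Bethe vectors of the row space and the column space -/

section BoundaryVectors

variable {N : ℕ} {ω : ℂ} {ι : Type*}

/-- The vector `∏_{j ∈ S} B(z_j)` applied to the auxiliary vector `e_τ`, for the auxiliary
`L`-operator. -/
def colVector (ω : ℂ) (q : Rapidity) (z : ι → ℂ) (τ : ZMod N) (S : Finset ι) : ZMod N → ℂ :=
  ((∏ j ∈ S, -(q.y * z j)) * ∏ ℓ ∈ Finset.range S.card, (1 - chr ω (τ + (ℓ : ZMod N) + 1))) •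
    Pi.single (τ + (S.card : ZMod N)) 1

/-- The row vector obtained from `e_{τ'}` by applying `rowB` at all `z_k`, `k ∈ S`. -/
def rowVector (ω : ℂ) (s : ZMod N) (q : Rapidity) (z : ι → ℂ) (τ' : ZMod N) (S : Finset ι) :
    ZMod N → ℂ :=
  ((∏ k ∈ S, (muDen ω s q (z k))⁻¹ * (q.y * z k)) * ∏ ℓ ∈ Finset.range S.card,
    ((chr ω (τ' - (ℓ : ZMod N)))⁻¹ * (1 - chr ω (τ' - (ℓ : ZMod N))))) •
    Pi.single (τ' - (S.card : ZMod N)) 1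

theorem colVector_empty (q : Rapidity) (z : ι → ℂ) (τ : ZMod N) :
    colVector ω q z τ ∅ = Pi.single τ 1 := by
  simp [colVector]

theorem rowVector_empty (s : ZMod N) (q : Rapidity) (z : ι → ℂ) (τ' : ZMod N) :
    rowVector ω s q z τ' ∅ = Pi.single τ' 1 := by
  simp [rowVector]

end BoundaryVectors

/-! ### Splitting off the row space and the column space -/

section Composite

variable {N L : ℕ} [NeZero N] {ω : ℂ}

/-- The monodromy matrix of the `τ₂`-chain extended by the auxiliary `L`-operator. -/
def extT (ω : ℂ) (p : Fin L → Rapidity) (q : Rapidity) (s : ZMod N) (z : ℂ) :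
    Matrix (Fin 2) (Fin 2) (BigOp N L) :=
  bigT ω p z * auxL L ω q s z

theorem isRTT_extT (h : ω ^ N = 1) (p : Fin L → Rapidity) (q : Rapidity) (s : ZMod N) (u v : ℂ) :
    IsRTT ω u v (extT ω p q s u) (extT ω p q s v) :=
  ((isRTT_tau2T h p u v).map _).mul ((isRTT_cyclicL h _ _ u v).map _)
    (fun _ _ _ _ => (commute_quantumHom_auxHom _ _).symm)
    (fun _ _ _ _ => commute_quantumHom_auxHom _ _)

theorem continuous_extT (p : Fin L → Rapidity) (q : Rapidity) (s : ZMod N) :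
    Continuous fun z => extT ω p q s z := by
  have h₁ : Continuous (quantumHom N L) :=
    LinearMap.continuous_of_finiteDimensional (quantumHom N L).toLinearMap
  have h₂ : Continuous (auxHom N L) :=
    LinearMap.continuous_of_finiteDimensional (auxHom N L).toLinearMap
  exact ((continuous_tau2T p).matrix_map h₁).mul ((continuous_cyclicL _ _).matrix_map h₂)

/-- The extended monodromy matrix acts on chain `⊗` column space as on a composite system. -/
theorem extT_mulVec_tensorPair (p : Fin L → Rapidity) (q : Rapidity) (s : ZMod N) (z : ℂ)
    (i j : Fin 2) (v : ChainOp N L) (x : ZMod N → ℂ) :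
    extT ω p q s z i j *ᵥ tensorPair N L v x =
      tensorPair N L (tau2T ω p z i 0 * v) (cyclicL ω q (q.barShift ω s) z 0 j *ᵥ x) +
      tensorPair N L (tau2T ω p z i 1 * v) (cyclicL ω q (q.barShift ω s) z 1 j *ᵥ x) := by
  simp only [extT, Matrix.mul_apply, Fin.sum_univ_two, Matrix.add_mulVec, ← Matrix.mulVec_mulVec,
    bigT, auxL, Matrix.map_apply, auxHom_mulVec_tensorPair, quantumHom_mulVec_tensorPair]

theorem extT_D_mulVec_vac (h : ω ^ N = 1) {p : Fin L → Rapidity} (hp : ∀ i, (p i).μ ≠ 0)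
    {q : Rapidity} (hq : q.μ ≠ 0) (s : ZMod N) (z : ℂ) (τ : ZMod N) :
    extT ω p q s z 1 1 *ᵥ tensorPair N L (vacProj N L) (Pi.single τ 1) =
      (d ω p z * (1 - q.t * z * ω * chr ω τ)) •
        tensorPair N L (vacProj N L) (Pi.single τ 1) := by
  obtain ⟨-, hC, hD⟩ := tau2T_mul_vacProj h p hp z
  rw [extT_mulVec_tensorPair, hC, hD, map_zero, LinearMap.zero_apply, zero_add,
    cyclicL_barShift h hq]
  simp only [Matrix.of_apply, Matrix.cons_val', Matrix.cons_val_one, Matrix.cons_val_fin_one]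
  rw [wShift_mulVec_single, add_zero, map_smul, map_smul, LinearMap.smul_apply, smul_smul,
    mul_comm]

theorem extT_D_mulVec_B (h : ω ^ N = 1) (p : Fin L → Rapidity) (q : Rapidity) (s : ZMod N)
    {u v : ℂ} (huv : u ≠ v) (ψ : ZMod N → ChainOp N L) :
    extT ω p q s u 1 1 *ᵥ extT ω p q s v 0 1 *ᵥ ψ =
      exchF ω v u • extT ω p q s v 0 1 *ᵥ extT ω p q s u 1 1 *ᵥ ψ +
      (-exchG ω u v) • extT ω p q s u 0 1 *ᵥ extT ω p q s v 1 1 *ᵥ ψ := by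
  rw [Matrix.mulVec_mulVec, (isRTT_extT h p q s u v).D_mul_B huv, Matrix.add_mulVec,
    Matrix.smul_mulVec, Matrix.smul_mulVec, Matrix.mulVec_mulVec, Matrix.mulVec_mulVec]
  rfl

variable {ι : Type*} [DecidableEq ι]

/-- The Bethe vectors of the extended chain, split into chain (parameters in `I`) and column space
(the others). -/
theorem extT_betheVector (h : ω ^ N = 1) {p : Fin L → Rapidity} (hp : ∀ i, (p i).μ ≠ 0)
    {q : Rapidity} (hq : q.μ ≠ 0) (s : ZMod N) {z : ι → ℂ} (hz : Function.Injective z) (τ : ZMod N)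
    (b : Finset ι → ChainOp N L) (hb₀ : b ∅ = vacProj N L)
    (hb : ∀ i S, i ∉ S → b (insert i S) = B ω p (z i) * b S)
    (b' : Finset ι → ZMod N → ChainOp N L)
    (hb'₀ : b' ∅ = tensorPair N L (vacProj N L) (Pi.single τ 1))
    (hb' : ∀ i S, i ∉ S → b' (insert i S) = extT ω p q s (z i) 0 1 *ᵥ b' S) (S : Finset ι) :
    b' S = ∑ I ∈ S.powerset,
      ((∏ i ∈ I, ∏ j ∈ S \ I, exchF ω (z j) (z i)) * (∏ j ∈ S \ I, a p (z j)) *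
        ∏ i ∈ I, (1 - q.t * z i * ω * chr ω τ)) •
        tensorPair N L (b I) (colVector ω q z τ (S \ I)) := by
  have hδ₀ : ∀ i, cyclicL ω q (q.barShift ω s) (z i) 1 1 *ᵥ colVector ω q z τ ∅ =
      (1 - q.t * z i * ω * chr ω τ) • colVector ω q z τ ∅ := fun i => by
    rw [cyclicL_barShift h hq]
    simp only [Matrix.of_apply, Matrix.cons_val', Matrix.cons_val_one, Matrix.cons_val_fin_one]
    rw [colVector_empty, wShift_mulVec_single, add_zero]
  have hcol : ∀ i S, i ∉ S → colVector ω q z τ (insert i S) =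
      cyclicL ω q (q.barShift ω s) (z i) 0 1 *ᵥ colVector ω q z τ S := fun i S hi => by
    rw [cyclicL_barShift h hq]
    simp only [colVector, Finset.prod_insert hi, Finset.card_insert_of_notMem hi,
      Finset.prod_range_succ, Matrix.mulVec_smul, Matrix.of_apply, Matrix.cons_val',
      Matrix.cons_val_zero, Matrix.cons_val_one, Matrix.cons_val_fin_one, wShift_mulVec_single,
      smul_smul, Nat.cast_add, Nat.cast_one, ← add_assoc]
    congr 1
    ring
  refine composite_betheVector (tensorPair N L)
    (fun i => LinearMap.mulLeft ℂ (tau2T ω p (z i) 0 0))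
    (fun i => LinearMap.mulLeft ℂ (tau2T ω p (z i) 0 1))
    (fun i => Matrix.mulVecLin (cyclicL ω q (q.barShift ω s) (z i) 1 1))
    (fun i => Matrix.mulVecLin (cyclicL ω q (q.barShift ω s) (z i) 0 1))
    (fun i => bigVec (extT ω p q s (z i) 0 1))
    (fun i j => exchF ω (z i) (z j)) (fun i j => exchG ω (z i) (z j))
    (fun i => a p (z i)) (fun i => 1 - q.t * z i * ω * chr ω τ)
    b (colVector ω q z τ) b' hb hcol hb' ?_ ?_ ?_ ?_ S
  · rw [hb'₀, hb₀]
    simp [colVector]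
  · intro i x y
    exact extT_mulVec_tensorPair p q s (z i) 0 1 x y
  · refine apply_betheVector _ (fun i => LinearMap.mulLeft ℂ (tau2T ω p (z i) 0 1))
      (fun i j => exchF ω (z i) (z j)) (fun i j => exchG ω (z i) (z j))
      b (fun i => a p (z i)) hb ?_ ?_ ?_
    · intro i
      rw [hb₀]
      exact (tau2T_mul_vacProj h p hp (z i)).1
    · intro i j hij x
      have := congrArg (· * x) ((isRTT_tau2T h p (z j) (z i)).A_mul_B (hz.ne hij))
      simp only [add_mul, smul_mul_assoc, mul_assoc] at this
      exact this
    · intro i j k hij hik hjk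
      exact exch_A ω (hz.ne hij) (hz.ne hik) (hz.ne hjk)
  · refine apply_betheVector _ (fun i => Matrix.mulVecLin (cyclicL ω q (q.barShift ω s) (z i) 0 1))
      (fun i j => exchF ω (z j) (z i)) (fun i j => -exchG ω (z i) (z j))
      _ (fun i => 1 - q.t * z i * ω * chr ω τ) hcol hδ₀ ?_ ?_
    · intro i j hij x
      have := congrArg (· *ᵥ x) ((isRTT_cyclicL h q (q.barShift ω s) (z i) (z j)).D_mul_B
        (hz.ne hij))
      simp only [Matrix.add_mulVec, Matrix.smul_mulVec, ← Matrix.mulVec_mulVec] at this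
      exact this
    · intro i j k hij hik hjk
      exact exch_D ω (hz.ne hij) (hz.ne hik) (hz.ne hjk)

/-- Moving `B(z)` through the superintegrable monodromy matrix. -/
theorem B_mul_rowPair (hω : IsPrimitiveRoot ω N) {k k' : ℂ} (hk : k ≠ 0)
    {p : Fin L → Rapidity} {q : Rapidity} (hp : ∀ i, (p i).OnCurve N k k')
    (hq : q.OnCurve N k k') (hpx : ∀ i, ∀ m : ℕ, (p i).x ≠ q.x * ω ^ m)
    (hpy : ∀ i, ∀ m : ℕ, (p i).y ≠ q.y * ω ^ m) (s : ZMod N) {z : ℂ} (hz : muDen ω s q z ≠ 0)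
    (x : ZMod N → ℂ) (ψ : ZMod N → ChainOp N L) :
    B ω p z * rowPair (scpT ω p q (q.barShift ω s)) x ψ =
      rowPair (scpT ω p q (q.barShift ω s)) (x ᵥ* rowA ω s q z) (extT ω p q s z 0 1 *ᵥ ψ) +
      rowPair (scpT ω p q (q.barShift ω s)) (x ᵥ* rowB ω s q z) (extT ω p q s z 1 1 *ᵥ ψ) := by
  have h := hω.pow_eq_one
  have key := scpT_mul_bigT_mul_auxL hω hk hp hq hpx hpy s z
  set T : BigOp N L := scpT ω p q (q.barShift ω s)
  have ent : ∀ i, T * extT ω p q s z i 1 =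
      auxL L ω q s z i 0 * (bigT ω p z 0 1 * T) + auxL L ω q s z i 1 * (bigT ω p z 1 1 * T) := by
    intro i
    have := congrFun (congrFun key i) 1
    simp only [Matrix.scalar_apply, Matrix.diagonal_mul, Matrix.mul_diagonal] at this
    rw [extT, this, Matrix.mul_apply, Fin.sum_univ_two, add_mul, mul_assoc, mul_assoc]
  obtain ⟨r₀, r₁⟩ := row_mul_cyclicL h hq.1 s hz
  have hBT : quantumHom N L (B ω p z) * T =
      auxHom N L (rowA ω s q z) * (T * extT ω p q s z 0 1) +
      auxHom N L (rowB ω s q z) * (T * extT ω p q s z 1 1) := by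
    have r₀' := congrArg (auxHom N L) r₀
    have r₁' := congrArg (auxHom N L) r₁
    simp only [map_add, map_mul, map_one, map_zero] at r₀' r₁'
    have e : ∀ i j, auxL L ω q s z i j = auxHom N L (cyclicL ω q (q.barShift ω s) z i j) :=
      fun i j => rfl
    have eB : bigT ω p z 0 1 = quantumHom N L (B ω p z) := rfl
    rw [ent, ent, e, e, e, e, eB]
    generalize quantumHom N L (B ω p z) * T = t₁
    generalize bigT ω p z 1 1 * T = t₂
    calc t₁ = 1 * t₁ + 0 * t₂ := by rw [one_mul, zero_mul, add_zero]
      _ = _ := by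
        rw [← r₀', ← r₁']
        simp only [add_mul, mul_add, mul_assoc]
        abel
  rw [← rowPair_quantumHom_mul, hBT]
  have hadd : ∀ M M' : BigOp N L, rowPair (M + M') x ψ = rowPair M x ψ + rowPair M' x ψ := by
    intro M M'
    simp only [rowPair, LinearMap.mk₂_apply, Matrix.add_mulVec, Pi.add_apply, smul_add,
      Finset.sum_add_distrib]
  rw [hadd, rowPair_auxHom_mul, rowPair_auxHom_mul, rowPair_mul, rowPair_mul]

/-- The product of the `B(z)` applied to `T^{τ'}_τ |0⟩`, split into row space (parameters in `K`) and
extended chain (the others). -/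
theorem B_prod_mul_scpT (hω : IsPrimitiveRoot ω N) {k k' : ℂ} (hk : k ≠ 0)
    {p : Fin L → Rapidity} {q : Rapidity} (hp : ∀ i, (p i).OnCurve N k k')
    (hq : q.OnCurve N k k') (hpx : ∀ i, ∀ m : ℕ, (p i).x ≠ q.x * ω ^ m)
    (hpy : ∀ i, ∀ m : ℕ, (p i).y ≠ q.y * ω ^ m) (s : ZMod N) {z : ι → ℂ}
    (hz : Function.Injective z) (hqz : ∀ i, muDen ω s q (z i) ≠ 0) (τ' τ : ZMod N)
    (b' : Finset ι → ZMod N → ChainOp N L)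
    (hb'₀ : b' ∅ = tensorPair N L (vacProj N L) (Pi.single τ 1))
    (hb' : ∀ i S, i ∉ S → b' (insert i S) = extT ω p q s (z i) 0 1 *ᵥ b' S)
    (b : Finset ι → ChainOp N L)
    (hb₀ : b ∅ = scpT ω p q (q.barShift ω s) τ' τ * vacProj N L)
    (hb : ∀ i S, i ∉ S → b (insert i S) = B ω p (z i) * b S) (S : Finset ι) :
    b S = ∑ K ∈ S.powerset,
      ((∏ k ∈ K, ∏ j ∈ S \ K, exchF ω (z j) (z k)) *
        (∏ j ∈ S \ K, (muDen ω s q (z j))⁻¹ * ((chr ω τ')⁻¹ * (1 - q.t * z j * chr ω τ'))) *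
        ∏ k ∈ K, d ω p (z k) * (1 - q.t * z k * ω * chr ω τ)) •
        rowPair (scpT ω p q (q.barShift ω s)) (rowVector ω s q z τ' K) (b' (S \ K)) := by
  have h := hω.pow_eq_one
  have hrow : ∀ i S, i ∉ S → rowVector ω s q z τ' (insert i S) =
      rowVector ω s q z τ' S ᵥ* rowB ω s q (z i) := fun i S hi => by
    simp only [rowVector, rowB, Finset.prod_insert hi, Finset.card_insert_of_notMem hi,
      Finset.prod_range_succ, Matrix.smul_vecMul, single_vecMul_wShift,
      smul_smul, Nat.cast_add, Nat.cast_one, sub_sub]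
    congr 1
    ring
  refine composite_betheVector (rowPair (scpT ω p q (q.barShift ω s)))
    (fun i => Matrix.vecMulLinear (rowA ω s q (z i)))
    (fun i => Matrix.vecMulLinear (rowB ω s q (z i)))
    (fun i => bigVec (extT ω p q s (z i) 1 1))
    (fun i => bigVec (extT ω p q s (z i) 0 1))
    (fun i => LinearMap.mulLeft ℂ (B ω p (z i)))
    (fun i j => exchF ω (z i) (z j)) (fun i j => exchG ω (z i) (z j))
    (fun i => (muDen ω s q (z i))⁻¹ * ((chr ω τ')⁻¹ * (1 - q.t * z i * chr ω τ')))
    (fun i => d ω p (z i) * (1 - q.t * z i * ω * chr ω τ))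
    (rowVector ω s q z τ') b' b hrow hb' hb ?_ ?_ ?_ ?_ S
  · rw [hb₀, hb'₀]
    simp [rowVector, rowPair_single]
  · intro i x y
    exact B_mul_rowPair hω hk hp hq hpx hpy s (hqz i) x y
  · refine apply_betheVector _ (fun i => Matrix.vecMulLinear (rowB ω s q (z i)))
      (fun i j => exchF ω (z i) (z j)) (fun i j => exchG ω (z i) (z j))
      _ (fun i => (muDen ω s q (z i))⁻¹ * ((chr ω τ')⁻¹ * (1 - q.t * z i * chr ω τ'))) hrow
      ?_ ?_ ?_
    · intro i
      rw [rowVector_empty]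
      change Pi.single τ' 1 ᵥ* wShift _ 0 = _
      rw [single_vecMul_wShift, sub_zero]
    · intro i j hij x
      have := congrArg (x ᵥ* ·) (rowB_mul_rowA h s q (hz.ne hij))
      simp only [Matrix.vecMul_add, Matrix.vecMul_smul, ← Matrix.vecMul_vecMul] at this
      exact this
    · intro i j k hij hik hjk
      exact exch_A ω (hz.ne hij) (hz.ne hik) (hz.ne hjk)
  · refine apply_betheVector _ (fun i => bigVec (extT ω p q s (z i) 0 1))
      (fun i j => exchF ω (z j) (z i)) (fun i j => -exchG ω (z i) (z j))
      _ (fun i => d ω p (z i) * (1 - q.t * z i * ω * chr ω τ)) hb' ?_ ?_ ?_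
    · intro i
      rw [hb'₀]
      exact extT_D_mulVec_vac h (fun i => (hp i).1) hq.1 s (z i) τ
    · intro i j hij x
      exact extT_D_mulVec_B h p q s (hz.ne hij) x
    · intro i j k hij hik hjk
      exact exch_D ω (hz.ne hij) (hz.ne hik) (hz.ne hjk)

end Composite

/-! ### The coefficients and the index set -/

section Coefficients

variable {N n : ℕ} [NeZero N] {ω : ℂ}

/-- The coefficient `1 / μ_{τ'τ}(z)` is the product of the eigenvalue of `rowA` on `e_{τ'}` and that of
the entry `D` of the auxiliary `L`-operator on `e_τ`. -/
theorem one_div_mu (h : ω ^ N = 1) (s : ZMod N) (q : Rapidity) (τ' τ : ZMod N) (z : ℂ) :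
    1 / mu ω s q τ' τ z = (muDen ω s q z)⁻¹ * ((chr ω τ')⁻¹ * (1 - q.t * z * chr ω τ')) *
      (1 - q.t * z * ω * chr ω τ) := by
  have e : ω ^ (τ + 1).val = chr ω τ * ω := by
    change chr ω (τ + 1) = _
    rw [chr_add h, chr_one h]
  have e' : ω ^ τ'.val = chr ω τ' := rfl
  rw [mu, e, e', one_div_div, ← muDen, div_eq_mul_inv, mul_inv]
  ring

/-- The factors of `c_n^{τ'τ}(I; J; K)` that belong to `J`: an eigenvalue of `rowA` and a weight of the
entry `B` of the auxiliary `L`-operator. -/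
theorem nu_div_mu_right (h : ω ^ N = 1) (s : ZMod N) (q : Rapidity) (τ' τ : ZMod N) {z : ℂ}
    (hz : ∀ m : ℕ, q.t * z * ω ^ m ≠ 1) :
    nu ω q (τ + 1) z / mu ω s q τ' τ z =
      (muDen ω s q z)⁻¹ * ((chr ω τ')⁻¹ * (1 - q.t * z * chr ω τ')) * -(q.y * z) *
        (1 - chr ω (τ + 1)) := by
  have h1 : q.t * z * chr ω (τ + 1) - 1 ≠ 0 := sub_ne_zero.2 (hz _)
  have e : chr ω (τ + 1) = chr ω τ * ω := by rw [chr_add h, chr_one h]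
  have e' : ω ^ (τ + 1).val = chr ω (τ + 1) := rfl
  rw [div_eq_mul_one_div, one_div_mu h, nu, e']
  have e2 : 1 - q.t * z * ω * chr ω τ = -(q.t * z * chr ω (τ + 1) - 1) := by rw [e]; ring
  rw [e2, div_mul_eq_mul_div, div_eq_iff h1]
  ring

/-- The factors of `c_n^{τ'τ}(I; J; K)` that belong to `K`: a weight of `rowB` and an eigenvalue of the
entry `D` of the auxiliary `L`-operator. -/
theorem nu_div_mu_left (h : ω ^ N = 1) (s : ZMod N) (q : Rapidity) (τ' τ : ZMod N) {z : ℂ}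
    (hz : ∀ m : ℕ, q.t * z * ω ^ m ≠ 1) :
    -nu ω q τ' z / mu ω s q τ' τ z =
      (muDen ω s q z)⁻¹ * (q.y * z) * (1 - q.t * z * ω * chr ω τ) *
        ((chr ω τ')⁻¹ * (1 - chr ω τ')) := by
  have h1 : q.t * z * chr ω τ' - 1 ≠ 0 := sub_ne_zero.2 (hz _)
  have e' : ω ^ τ'.val = chr ω τ' := rfl
  rw [div_eq_mul_one_div, one_div_mu h, nu, e']
  have e2 : 1 - q.t * z * chr ω τ' = -(q.t * z * chr ω τ' - 1) := by ring
  rw [e2, ← neg_div, div_mul_eq_mul_div, div_eq_iff h1]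
  ring

theorem prod_enumeration {S : Finset (Fin n)} (e : Fin S.card ≃ S) (g : Fin n → ℂ) (c : ℕ → ℂ) :
    ∏ ℓ : Fin S.card, g (e ℓ) * c ℓ = (∏ j ∈ S, g j) * ∏ ℓ ∈ Finset.range S.card, c ℓ := by
  rw [Finset.prod_mul_distrib, Fin.prod_univ_eq_prod_range, Equiv.prod_comp e fun j => g j,
    Finset.prod_coe_sort]

/-- The coefficient `c_n^{τ'τ}(I; J; K)` in the form produced by the two splittings. The dependence on
the enumerations of `J` and `K` disappears because each factor separates into one that depends on
the parameter and one that depends on its position. -/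
theorem coeff_eq (hω : IsPrimitiveRoot ω N) (s : ZMod N) (q : Rapidity) (z : Fin n → ℂ)
    (hqz : ∀ i, ∀ m : ℕ, q.t * z i * ω ^ m ≠ 1) (τ' τ : ZMod N) {I J : Finset (Fin n)}
    (K : Finset (Fin n)) (hIJ : Disjoint I J) (eJ : Fin J.card ≃ J) (eK : Fin K.card ≃ K) :
    coeff ω s q z τ' τ I J K eJ eK =
      (∏ k ∈ K, ∏ j ∈ I ∪ J, exchF ω (z j) (z k)) *
        (∏ j ∈ I ∪ J, (muDen ω s q (z j))⁻¹ * ((chr ω τ')⁻¹ * (1 - q.t * z j * chr ω τ'))) *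
        (∏ k ∈ K, (1 - q.t * z k * ω * chr ω τ)) *
      ((∏ i ∈ I, ∏ j ∈ J, exchF ω (z j) (z i)) * ∏ i ∈ I, (1 - q.t * z i * ω * chr ω τ)) *
      ((∏ k ∈ K, (muDen ω s q (z k))⁻¹ * (q.y * z k)) * ∏ ℓ ∈ Finset.range K.card,
        ((chr ω (τ' - (ℓ : ZMod N)))⁻¹ * (1 - chr ω (τ' - (ℓ : ZMod N))))) *
      ((∏ j ∈ J, -(q.y * z j)) *
        ∏ ℓ ∈ Finset.range J.card, (1 - chr ω (τ + (ℓ : ZMod N) + 1))) := by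
  have h := hω.pow_eq_one
  have hω0 : ω ≠ 0 := hω.ne_zero (NeZero.ne N)
  unfold coeff
  simp only [one_div_mu h, nu_div_mu_right h s q _ _ (hqz _), nu_div_mu_left h s q _ _ (hqz _),
    omega_mul_f hω0]
  rw [prod_enumeration eJ (fun j => (muDen ω s q (z j))⁻¹ *
      ((chr ω τ')⁻¹ * (1 - q.t * z j * chr ω τ')) * -(q.y * z j))
      (fun ℓ => 1 - chr ω (τ + (ℓ : ZMod N) + 1)),
    prod_enumeration eK (fun k => (muDen ω s q (z k))⁻¹ * (q.y * z k) *
      (1 - q.t * z k * ω * chr ω τ))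
      (fun ℓ => (chr ω (τ' - (ℓ : ZMod N)))⁻¹ * (1 - chr ω (τ' - (ℓ : ZMod N)))),
    Finset.prod_comm (s := I) (t := K), Finset.prod_comm (s := J) (t := K)]
  simp only [Finset.prod_union hIJ, Finset.prod_mul_distrib]
  ring

/-- Three pairwise disjoint sets whose numbers of elements add up to `n` exhaust the index set, so `J`
is determined by `I` and `K`. -/
theorem mem_triples {I J K : Finset (Fin n)} :
    (I, J, K) ∈ triples n ↔ Disjoint I K ∧ J = (Finset.univ \ K) \ I := by
  simp only [triples, Finset.mem_filter, Finset.mem_univ, true_and]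
  constructor
  · rintro ⟨hIJ, hIK, hJK, hcard⟩
    refine ⟨hIK, Finset.eq_of_subset_of_card_le ?_ ?_⟩
    · intro x hx
      simp only [Finset.mem_sdiff, Finset.mem_univ, true_and]
      exact ⟨Finset.disjoint_left.1 hJK hx, Finset.disjoint_right.1 hIJ hx⟩
    · have hI : I ⊆ Finset.univ \ K := fun x hx =>
        Finset.mem_sdiff.2 ⟨Finset.mem_univ _, Finset.disjoint_left.1 hIK hx⟩
      rw [Finset.card_sdiff_of_subset hI, Finset.card_sdiff_of_subset (Finset.subset_univ K),
        Finset.card_univ, Fintype.card_fin]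
      omega
  · rintro ⟨hIK, rfl⟩
    have hI : I ⊆ Finset.univ \ K := fun x hx =>
      Finset.mem_sdiff.2 ⟨Finset.mem_univ _, Finset.disjoint_left.1 hIK hx⟩
    refine ⟨Finset.disjoint_sdiff, hIK, ?_, ?_⟩
    · exact Finset.disjoint_of_subset_left Finset.sdiff_subset Finset.sdiff_disjoint
    · have h₁ := Finset.card_le_card hI
      have h₂ := Finset.card_le_univ K
      rw [Finset.card_sdiff_of_subset hI]
      rw [Finset.card_sdiff_of_subset (Finset.subset_univ K), Finset.card_univ,
        Fintype.card_fin] at *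
      omega

end Coefficients

/-! ### Products in the order of an enumeration, and the expansion -/

theorem foldr_mul {R κ : Type*} [Monoid R] (β : κ → R) (l : List κ) (v : R) :
    l.foldr (fun i x => β i * x) v = (l.map β).prod * v := by
  induction l with
  | nil => simp
  | cons i l ih => simp [ih, mul_assoc]

/-- A family with `b(S ∪ {i}) = β_i b(S)` is given by products in the order of any enumeration. -/
theorem betheVector_eq_ofFn {R : Type*} [Monoid R] {n : ℕ} (β : Fin n → R)
    (b : Finset (Fin n) → R) (hb : ∀ i S, i ∉ S → b (insert i S) = β i * b S)
    {S : Finset (Fin n)} {r : ℕ} (e : Fin r ≃ S) :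
    b S = (List.ofFn fun ℓ => β (e ℓ)).prod * b ∅ := by
  have h₁ : (List.ofFn fun ℓ => (e ℓ : Fin n)).Nodup :=
    List.nodup_ofFn.2 (Subtype.val_injective.comp e.injective)
  have h₂ : (List.ofFn fun ℓ => (e ℓ : Fin n)).toFinset = S := by
    ext i
    simp only [List.mem_toFinset, List.mem_ofFn]
    constructor
    · rintro ⟨ℓ, rfl⟩
      exact (e ℓ).2
    · intro hi
      exact ⟨e.symm ⟨i, hi⟩, by simp⟩
  have key := betheVector_toFinset (fun i x => β i * x) b hb _ h₁
  rw [h₂, foldr_mul, List.map_ofFn] at key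
  exact key

/-- The expansion of `B(z₁) ⋯ B(zₙ) T^{τ'}_τ |0⟩`, with the projector onto the reference state in
place of the state itself. -/
theorem B_prod_mul_scpT_mul_vacProj {N L n : ℕ} [NeZero N] {ω : ℂ} (hω : IsPrimitiveRoot ω N)
    {k k' : ℂ} (hk : k ≠ 0) (p : Fin L → Rapidity) (q : Rapidity)
    (hp : ∀ i, (p i).OnCurve N k k') (hq : q.OnCurve N k k')
    (hpx : ∀ i, ∀ m : ℕ, (p i).x ≠ q.x * ω ^ m)
    (hpy : ∀ i, ∀ m : ℕ, (p i).y ≠ q.y * ω ^ m)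
    (s : ZMod N) (z : Fin n → ℂ) (hz : Function.Injective z)
    (hqz : ∀ i, ∀ m : ℕ, q.t * z i * ω ^ m ≠ 1)
    (e : ∀ I : Finset (Fin n), Fin I.card ≃ I) (τ' τ : ZMod N) :
    (List.ofFn fun i => B ω p (z i)).prod * (scpT ω p q (q.barShift ω s) τ' τ * vacProj N L) =
      ∑ P ∈ triples n,
        (coeff ω s q z τ' τ P.1 P.2.1 P.2.2 (e P.2.1) (e P.2.2) *
            (∏ j ∈ P.2.1, a p (z j)) * (∏ k ∈ P.2.2, d ω p (z k))) •
          (scpT ω p q (q.barShift ω s)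
                (τ' - (P.2.2.card : ZMod N)) (τ + (P.2.1.card : ZMod N)) *
              ((List.ofFn fun ℓ => B ω p (z (e P.1 ℓ))).prod * vacProj N L)) := by
  have h := hω.pow_eq_one
  -- The exponents `m = 0` and `m = s` of the hypothesis on `t_q z_i`.
  have hden : ∀ i, muDen ω s q (z i) ≠ 0 := fun i =>
    mul_ne_zero (sub_ne_zero.2 (by simpa using hqz i 0)) (sub_ne_zero.2 (hqz i s.val))
  have hB : ∀ u v, Commute (B (N := N) ω p u) (B ω p v) :=
    commute_B_of_isRTT (isRTT_tau2T h p) ((continuous_tau2T p).matrix_elem 0 1)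
  have hB' : ∀ u v, Commute (extT (N := N) ω p q s u 0 1) (extT ω p q s v 0 1) :=
    commute_B_of_isRTT (isRTT_extT h p q s) ((continuous_extT p q s).matrix_elem 0 1)
  have hBl : ∀ i j (x : ChainOp N L), LinearMap.mulLeft ℂ (B ω p (z i))
      (LinearMap.mulLeft ℂ (B ω p (z j)) x) =
      LinearMap.mulLeft ℂ (B ω p (z j)) (LinearMap.mulLeft ℂ (B ω p (z i)) x) := fun i j x => by
    simp only [LinearMap.mulLeft_apply, ← mul_assoc, (hB _ _).eq]
  -- Bethe vectors of the chain over `|0⟩`, of the chain over `T |0⟩`, and of the extended chain.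
  obtain ⟨b, hb₀, hb⟩ := exists_betheVector (fun i => LinearMap.mulLeft ℂ (B ω p (z i))) hBl
    (vacProj N L)
  obtain ⟨c, hc₀, hc⟩ := exists_betheVector (fun i => LinearMap.mulLeft ℂ (B ω p (z i))) hBl
    (scpT ω p q (q.barShift ω s) τ' τ * vacProj N L)
  obtain ⟨b', hb'₀, hb'⟩ := exists_betheVector (fun i => bigVec (extT ω p q s (z i) 0 1))
    (fun i j ψ => by
      change _ *ᵥ _ *ᵥ ψ = _ *ᵥ _ *ᵥ ψ
      rw [Matrix.mulVec_mulVec, (hB' _ _).eq, ← Matrix.mulVec_mulVec])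
    (tensorPair N L (vacProj N L) (Pi.single τ 1))
  have hL := B_prod_mul_scpT hω hk hp hq hpx hpy s hz hden τ' τ b' hb'₀ hb' c hc₀ hc Finset.univ
  have hR := extT_betheVector h (fun i => (hp i).1) hq.1 s hz τ b hb₀ hb b' hb'₀ hb'
  have hcu : c Finset.univ = (List.ofFn fun i => B ω p (z i)).prod *
      (scpT ω p q (q.barShift ω s) τ' τ * vacProj N L) := by
    have := betheVector_eq_ofFn (fun i => B ω p (z i)) c hc
      (Equiv.subtypeUnivEquiv (fun i : Fin n => Finset.mem_univ i)).symm
    rw [this, hc₀]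
    rfl
  rw [← hcu, hL]
  simp only [hR, map_sum, map_smul, Finset.smul_sum, smul_smul]
  -- Nested pairs `K`, `I ⊆ Kᶜ` correspond to triples `(I, J, K)` with `J = Kᶜ \ I`.
  rw [Finset.sum_sigma']
  refine Finset.sum_bij' (fun x _ => (x.2, (Finset.univ \ x.1) \ x.2, x.1))
    (fun P _ => ⟨P.2.2, P.1⟩) ?_ ?_ ?_ ?_ ?_
  · rintro ⟨K, I⟩ hx
    simp only [Finset.mem_sigma, Finset.mem_powerset] at hx
    refine mem_triples.2 ⟨?_, rfl⟩
    exact Finset.disjoint_of_subset_left hx.2 Finset.sdiff_disjoint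
  · rintro ⟨I, J, K⟩ hP
    obtain ⟨hIK, -⟩ := mem_triples.1 hP
    simp only [Finset.mem_sigma, Finset.mem_powerset]
    exact ⟨Finset.subset_univ _, fun x hx =>
      Finset.mem_sdiff.2 ⟨Finset.mem_univ _, Finset.disjoint_left.1 hIK hx⟩⟩
  · rintro ⟨K, I⟩ _
    rfl
  · rintro ⟨I, J, K⟩ hP
    obtain ⟨-, hJ⟩ := mem_triples.1 hP
    simp only [hJ]
  · rintro ⟨K, I⟩ hx
    simp only [Finset.mem_sigma, Finset.mem_powerset] at hx
    have hU : Finset.univ \ K = I ∪ (Finset.univ \ K) \ I := (Finset.union_sdiff_of_subset hx.2).symm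
    have hdisj : Disjoint I ((Finset.univ \ K) \ I) := Finset.disjoint_sdiff
    simp only
    rw [coeff_eq hω s q z hqz τ' τ K hdisj, rowVector, colVector]
    generalize (Finset.univ \ K) \ I = J at *
    rw [hU]
    simp only [map_smul, LinearMap.smul_apply, smul_smul]
    rw [rowPair_single, betheVector_eq_ofFn (fun i => B ω p (z i)) b hb (e I), hb₀]
    congr 1
    simp only [Finset.prod_mul_distrib]
    ring

end

end SCP

theorem mainTheorem2 (N L n : ℕ) [NeZero N] (ω : ℂ) (hω : IsPrimitiveRoot ω N)
    (k k' : ℂ) (hk : k ≠ 0) (hkk' : k ^ 2 + k' ^ 2 = 1)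
    (p : Fin L → SCP.Rapidity) (q : SCP.Rapidity)
    (hp : ∀ i, (p i).OnCurve N k k') (hq : q.OnCurve N k k')
    (hpx : ∀ i, ∀ m : ℕ, (p i).x ≠ q.x * ω ^ m)
    (hpy : ∀ i, ∀ m : ℕ, (p i).y ≠ q.y * ω ^ m)
    (s : ZMod N) (z : Fin n → ℂ) (hz : Function.Injective z)
    (hqz : ∀ i, ∀ m : ℕ, q.t * z i * ω ^ m ≠ 1)
    (e : ∀ I : Finset (Fin n), Fin I.card ≃ I) (τ' τ : ZMod N) :
    ((List.ofFn fun i => SCP.B ω p (z i)).prod *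
        SCP.scpT ω p q (q.barShift ω s) τ' τ) *ᵥ SCP.vac N L =
      ∑ P ∈ SCP.triples n,
        (SCP.coeff ω s q z τ' τ P.1 P.2.1 P.2.2 (e P.2.1) (e P.2.2) *
            (∏ j ∈ P.2.1, SCP.a p (z j)) * (∏ k ∈ P.2.2, SCP.d ω p (z k))) •
          ((SCP.scpT ω p q (q.barShift ω s)
                (τ' - (P.2.2.card : ZMod N)) (τ + (P.2.1.card : ZMod N)) *
              (List.ofFn fun ℓ => SCP.B ω p (z (e P.1 ℓ))).prod) *ᵥ SCP.vac N L) := by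
  -- The reference state is fixed by its projector, so applying both sides to it removes the projector.
  have key := congrArg (· *ᵥ SCP.vac N L)
    (SCP.B_prod_mul_scpT_mul_vacProj hω hk p q hp hq hpx hpy s z hz hqz e τ' τ)
  simp only [← mul_assoc, Matrix.sum_mulVec, Matrix.smul_mulVec] at key
  simp only [← Matrix.mulVec_mulVec _ _ (SCP.vacProj N L), SCP.vacProj_mulVec] at key
  exact key
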